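/- Let $n\ge m\ge 3$ and consider three codeblocks $A_1,A_2,A_3$, each an $m\times n$ lattice of qubits encoded in the $Z$-gauge Bacon-Shor code: the stabilizer group of each block is generated by $Z_{i,j}Z_{i,j+1}$ (all rows $i$, adjacent columns $j,j+1$) and by $X_{i,*}X_{i+1,*}$ (adjacent rows), where $X_{i,*}=\prod_j X_{i,j}$. For a vector $\alpha$ of signs of the generators $s_k$ (a syndrome) let $P_\alpha=\prod_k\frac{1}{2}(I+(-1)^{\alpha_k}s_k)$, and let $P=P_0$ be the codespace projector. A CCZ-form circuit $C$ is a sequence of timesteps $S_1,\dots,S_h$, each a set of CCZ gates with disjoint supports, such that each gate acts on one qubit of each block and no gate occurs twice; in each timestep the qubits not touched by a CCZ gate undergo single-qubit identity gates, which also belong to $S_v$. For a set of qubits $Q$ put $l_v(Q)=\{i:\exists g\in S_v,\ j\in Q \text{ with } \{i,j\}\subseteq\mathrm{supp}(g)\}$ (so $Q\subseteq l_v(Q)$), and define the modified lightcone of a CCZ gate $g\in S_t$ as $\tilde{\mathcal L}(g)=\bigcup_{v=t+1}^{h}l_v(\mathrm{supp}(g))$. Circuit depolarizing noise of strength $p=\epsilon^2$: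 every gate, identity gates included, fails independently with probability $p$, and a failing $k$-qubit gate is followed by a uniformly random one of the $4^k-1$ non-identity Paulis on its support. Propagating the Paulis of each pattern $f$ of errors to the end of the circuit gives the Kraus operators $E_f(\epsilon)=\sqrt{\Pr(f)}\,N_fU^\dagger$, where $N_f$ is the circuit with the errors $f$ inserted and $U$ is the ideal circuit. The noise is said to be correctable with effective distance $d$ using stabilizer projective recovery (SPR) if there are Hermitian matrices $\gamma^{(\alpha)}(\epsilon)$ such that for all syndromes $\alpha$ and all $f,f'$ $$P\,E_f(\epsilon)^\dagger P_\alpha E_{f'}(\epsilon)\,P=\gamma^{(\alpha)}_{ff'}(\epsilon)\,P+O(\epsilon^d)\qquad(\epsilon\to0^+).$$ Then: (1) If the modified lightcone of every CCZ gate of $C$ meets each block in at most two rows, then the noise in $C$ is correctable with effective distance $m$ using SPR. (2) Suppose that no CCZ gate of $C$ is repeated up to $Z$-gauge operators, in the sense that two distinct CCZ gates of $C$ that have a qubit in common never act on the same row in each of the three blocks. If the noise in $C$ is correctable with effective distance $m$ using SPR, then the modified lightcone of every CCZ gate of $C$ meets each block in at most two rows. In particular, for circuits as in (2) the two properties are equivalent.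 -/

import Mathlib

open Matrix Asymptotics Topology

noncomputable section

namespace BaconShorCCZ

/-! ### Qubits, Pauli strings and the code -/

/-- The physical qubits of three `m × n` codeblocks: `(b, i, j)` is the qubit in row `i` and
column `j` of block `b`. -/
abbrev Qubit (m n : ℕ) := Fin 3 × Fin m × Fin n

/-- Computational basis states. -/
abbrev Config (m n : ℕ) := Qubit m n → Fin 2

/-- Operators on the Hilbert space of all `3mn` qubits, as matrices in the computational basis. -/
abbrev Op (m n : ℕ) := Matrix (Config m n) (Config m n) ℂ

/-- The Pauli matrices `σ⁰ = I`, `σ¹ = X`, `σ² = Y`, `σ³ = Z`. -/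
def pauli : Fin 4 → Matrix (Fin 2) (Fin 2) ℂ :=
  ![1, !![0, 1; 1, 0], !![0, -Complex.I; Complex.I, 0], !![1, 0; 0, -1]]

/-- The tensor product `⨂_q σ^{v q}` of single-qubit Paulis. -/
def pauliString {m n : ℕ} (v : Qubit m n → Fin 4) : Op m n :=
  Matrix.of fun x y => ∏ q, pauli (v q) (x q) (y q)

/-- Labels of the stabilizer generators of three `Z`-gauge Bacon-Shor blocks: `inl (b, i, j)` is
the gauge operator `Z_{i,j} Z_{i,j+1}` of block `b` and `inr (b, i)` is the operator
`X_{i,*} X_{i+1,*}` of block `b`. (The column stabilizers `Z_{*,j} Z_{*,j+1}` are products of the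
former.) -/
abbrev Gen (m n : ℕ) := (Fin 3 × Fin m × Fin (n - 1)) ⊕ (Fin 3 × Fin (m - 1))

/-- The Pauli labels of a stabilizer generator. -/
def genLabel {m n : ℕ} : Gen m n → Qubit m n → Fin 4
  | Sum.inl (b, i, j), q =>
      if q.1 = b ∧ q.2.1 = i ∧ (q.2.2.val = j.val ∨ q.2.2.val = j.val + 1) then 3 else 0
  | Sum.inr (b, i), q =>
      if q.1 = b ∧ (q.2.1.val = i.val ∨ q.2.1.val = i.val + 1) then 1 else 0

/-- The stabilizer generators as operators. -/
def stabGen {m n : ℕ} (k : Gen m n) : Op m n := pauliString (genLabel k)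

/-- The projector `P_α = ∏_k (I + (-1)^{α_k} s_k) / 2` onto a syndrome space. The factors commute,
so that the order of the product is immaterial. -/
def syndromeProj {m n : ℕ} (α : Gen m n → Fin 2) : Op m n :=
  ((Finset.univ : Finset (Gen m n)).toList.map fun k =>
    (2⁻¹ : ℂ) • (1 + ((-1 : ℂ) ^ (α k).val) • stabGen k)).prod

/-- The projector `P` onto the codespace, the common `+1`-eigenspace of all stabilizers. -/
def codeProj (m n : ℕ) : Op m n := syndromeProj fun _ => 0

/-- A family of Kraus operators `E_i(ε)`, `i ∈ ι`, has effective distance `d` using stabilizer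
projective recovery if there are Hermitian matrices `γ^{(α)}(ε)` with
`P E_i(ε)† P_α E_j(ε) P = γ^{(α)}_{ij}(ε) P + O(ε^d)` as `ε → 0⁺`, for all syndromes `α` and all
`i, j`. (The bound is stated for each matrix entry.) -/
def HasEffectiveDistanceSPR {m n : ℕ} {ι : Type} (E : ℝ → ι → Op m n) (d : ℕ) : Prop :=
  ∃ γ : (Gen m n → Fin 2) → ℝ → Matrix ι ι ℂ,
    (∀ α ε, (γ α ε).IsHermitian) ∧
    ∀ (α : Gen m n → Fin 2) (i j : ι) (x y : Config m n),
      (fun ε : ℝ =>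
        (codeProj m n * (E ε i)ᴴ * syndromeProj α * E ε j * codeProj m n
          - γ α ε i j • codeProj m n) x y) =O[𝓝[>] (0 : ℝ)] fun ε : ℝ => ε ^ d

/-! ### CCZ-form circuits -/

/-- A CCZ gate on one qubit of each block: `g b` is the position (row, column) of its qubit in
block `b`. -/
abbrev CCZGate (m n : ℕ) := Fin 3 → Fin m × Fin n

/-- The qubits on which a gate acts. -/
def supp {m n : ℕ} (g : CCZGate m n) : Finset (Qubit m n) :=
  Finset.univ.image fun b => (b, g b)

/-- A CCZ-form circuit whose three sets of qubits are the codeblocks: a sequence of timesteps,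
each a set of CCZ gates with disjoint supports, in which no gate is repeated. -/
structure CCZCircuit (m n : ℕ) where
  depth : ℕ
  step : Fin depth → Finset (CCZGate m n)
  disjoint_supp : ∀ t, ∀ g ∈ step t, ∀ g' ∈ step t, g ≠ g' → Disjoint (supp g) (supp g')
  no_repeat : ∀ t t' g, g ∈ step t → g ∈ step t' → t = t'

namespace CCZCircuit

variable {m n : ℕ} (C : CCZCircuit m n)

/-- The supports of all gates of timestep `t`: those of the CCZ gates, and the singleton `{q}` for
each qubit `q` that idles, i.e. undergoes the identity gate. They partition the qubits. -/
def gateSupports (t : Fin C.depth) : Finset (Finset (Qubit m n)) :=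
  (C.step t).image supp ∪
    (Finset.univ.filter fun q => ∀ g ∈ C.step t, q ∉ supp g).image fun q => {q}

/-- `l_v(Q)`: the qubits that share a gate of timestep `v` with a qubit of `Q`. As identity gates
are gates, it contains `Q`. -/
def spread (v : Fin C.depth) (Q : Finset (Qubit m n)) : Finset (Qubit m n) :=
  Finset.univ.filter fun i => ∃ s ∈ C.gateSupports v, ∃ j ∈ Q, i ∈ s ∧ j ∈ s

/-- The modified lightcone `⋃_{v > t} l_v(supp g)` of a gate `g` of timestep `t`. -/
def modifiedLightcone (t : Fin C.depth) (g : CCZGate m n) : Finset (Qubit m n) :=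
  (Finset.univ.filter fun v => t < v).biUnion fun v => C.spread v (supp g)

/-- The rows of block `b` that a set of qubits meets. -/
def rowsMet (b : Fin 3) (Q : Finset (Qubit m n)) : Finset (Fin m) :=
  (Q.filter fun q => q.1 = b).image fun q => q.2.1

/-- The modified lightcone of every CCZ gate meets every block in at most two rows. -/
def TwoRowLightcones : Prop :=
  ∀ t, ∀ g ∈ C.step t, ∀ b, (rowsMet b (C.modifiedLightcone t g)).card ≤ 2

/-- No gate is repeated up to `Z`-gauge operators: two gates of the circuit that have a qubit in
common and act on the same row in each of the three blocks coincide. (CCZ gates on the same three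
rows act in the same way on the code, so that a pair of them cancels.) -/
def IsReduced : Prop :=
  ∀ t t', ∀ g ∈ C.step t, ∀ g' ∈ C.step t',
    (∃ b, g b = g' b) → (∀ b, (g b).1 = (g' b).1) → g = g'

/-! ### Circuit depolarizing noise -/

/-- The unitary of timestep `t`, the product of its CCZ gates. A CCZ gate is diagonal, with the
phase `-1` at the basis states in which its three qubits are all `1`. -/
def stepUnitary (t : Fin C.depth) : Op m n :=
  Matrix.diagonal fun x => ∏ g ∈ C.step t, if ∀ b, x (b, g b) = 1 then (-1 : ℂ) else 1

/-- A pattern of Pauli errors: the Pauli string that follows each timestep. As the gate supports of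
a timestep partition the qubits, this is one Pauli error (possibly the identity) on the support of
each gate. -/
abbrev ErrorPattern := Fin C.depth → Qubit m n → Fin 4

/-- The circuit in which each timestep `t` is followed by the Pauli string `f t`. -/
def run (f : C.ErrorPattern) : Op m n :=
  (List.finRange C.depth).foldl (fun A t => pauliString (f t) * C.stepUnitary t * A) 1

/-- The ideal circuit. -/
def ideal : Op m n :=
  (List.finRange C.depth).foldl (fun A t => C.stepUnitary t * A) 1

/-- The Pauli errors of a pattern, propagated to the end of the circuit: the operator `F` for
which the noisy circuit is `F` after the ideal circuit. -/
def propagated (f : C.ErrorPattern) : Op m n := C.run f * C.idealᴴ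

/-- The amplitude of an error pattern under depolarizing noise of strength `p = ε²`. The gates,
identity gates included, fail independently with probability `p`, and a failing gate on `k` qubits
suffers each of the `4^k - 1` non-identity Paulis on its support with equal probability. -/
def amplitude (f : C.ErrorPattern) (ε : ℝ) : ℝ :=
  ∏ t, ∏ s ∈ C.gateSupports t,
    if ∃ q ∈ s, f t q ≠ 0 then ε / Real.sqrt (4 ^ s.card - 1) else Real.sqrt (1 - ε ^ 2)

/-- The Kraus operators of circuit depolarizing noise with error parameter `ε = √p`. -/
def kraus (ε : ℝ) (f : C.ErrorPattern) : Op m n :=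
  ((C.amplitude f ε : ℝ) : ℂ) • C.propagated f

end CCZCircuit

end BaconShorCCZ

end

noncomputable section

namespace BaconShorCCZ

/-! ### Monomial operators -/

variable {m n : ℕ}

/-! CCZ gates are diagonal, so errors propagated to the end of the circuit form a monomial operator:
it shifts basis states by the sum of the bit flips of all errors (the frame) and multiplies by a
phase. The phase collects the `Z` parts and, for each gate, the change of its CCZ phase under the
flips that precede it. A pattern with `k` failing gates has amplitude of exact order `ε ^ k`. What
matters is therefore whether `P F† P_α F' P` (`sandwich`) is a multiple of `P` for pairs of patterns
with fewer than `m` failures in total. An operator is a multiple of `P` once it absorbs all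
stabilizers and commutes with one logical `X` and one logical `Z` per block
(`IsScalarOnCode.eq_smul`).

Sufficiency. If the two frames differ, their sum cannot be constant along all rows, since a failing
gate has at most one qubit per block and there are fewer than `n` failures; some `ZZ` generator then
anticommutes and the sandwich vanishes. If the frames agree, column `Z` operators commute with the
sandwich. A row operator `X_{r,*}` commutes too as soon as no failure touches row `r`, so an
untouched row is needed in each block. Small lightcones let a failure touch at most two rows of a
block. As the frames agree, every flipped qubit is flipped a second time, and the resulting overlaps
show that there are no more touched rows than failures (`card_touchedRows_le`), hence fewer than
`m`.

Necessity. Take a gate `g` with a large lightcone in block `c`, in the last timestep that has one,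
and let it fail with `X` on its qubits in the other two blocks. Moving an `X` stabilizer `S` of
those blocks past this error and the later gates leaves `Z` operators on some rows of `c`
(`residue`). Reducedness and the smallness of later lightcones give an `S` whose residue contains
two rows other than that of `g`. A second pattern adds `Z` on the complementary rows, with the `Z`
on the row of `g` placed in the failing gate itself. Together the two patterns cost at most `1 + (1
+ (m - 3)) = m - 1` failures and produce a logical `Z`, which is no multiple of `P`. As `S` is a
linear combination of the `P_α`, this contradicts distance `m`. -/

lemma Config.add_self (x : Config m n) : x + x = 0 := by
  funext q
  have : ∀ a : Fin 2, a + a = 0 := by decide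
  exact this (x q)

lemma Config.add_add_cancel (x y : Config m n) : x + y + y = x := by
  rw [add_assoc, Config.add_self, add_zero]

lemma Config.eq_add_iff (x y A : Config m n) : x = y + A ↔ y = x + A := by
  constructor <;> (rintro rfl; rw [Config.add_add_cancel])

/-- The operator that maps the basis state `y` to `φ y` times the basis state `y + A`. -/
def mono (A : Config m n) (φ : Config m n → ℂ) : Op m n :=
  Matrix.of fun x y => if x = y + A then φ y else 0

lemma mono_apply (A : Config m n) (φ : Config m n → ℂ) (x y : Config m n) :
    mono A φ x y = if x = y + A then φ y else 0 := rfl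

lemma mono_mul_apply (A : Config m n) (φ : Config m n → ℂ) (M : Op m n) (x y : Config m n) :
    (mono A φ * M) x y = φ (x + A) * M (x + A) y := by
  simp [Matrix.mul_apply, mono_apply, Config.eq_add_iff x]

lemma mul_mono_apply (A : Config m n) (φ : Config m n → ℂ) (M : Op m n) (x y : Config m n) :
    (M * mono A φ) x y = M x (y + A) * φ y := by
  simp [Matrix.mul_apply, mono_apply]

lemma mono_mul_mono (A B : Config m n) (φ ψ : Config m n → ℂ) :
    mono A φ * mono B ψ = mono (A + B) fun y => φ (y + B) * ψ y := by
  ext x y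
  rw [mul_mono_apply, mono_apply, mono_apply, add_assoc, add_comm B A]
  split_ifs <;> simp

lemma mono_conjTranspose (A : Config m n) (φ : Config m n → ℂ) :
    (mono A φ)ᴴ = mono A fun y => star (φ (y + A)) := by
  ext x y
  rw [Matrix.conjTranspose_apply, mono_apply, mono_apply]
  by_cases h : x = y + A
  · rw [if_pos h, if_pos ((Config.eq_add_iff _ _ _).1 h), h]
  · rw [if_neg h, if_neg (fun h' => h ((Config.eq_add_iff _ _ _).1 h')), star_zero]

lemma diagonal_eq_mono (φ : Config m n → ℂ) : Matrix.diagonal φ = mono 0 φ := by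
  ext x y
  rw [Matrix.diagonal_apply, mono_apply, add_zero]
  split_ifs with h <;> simp [h]

lemma one_eq_mono : (1 : Op m n) = mono 0 fun _ => 1 := by
  rw [← diagonal_eq_mono, Matrix.diagonal_one]

/-- A character with values `±1` changes by its value on the shift; this is the commutation rule of
a `Z`-type operator with any monomial operator, whatever the phase. -/
lemma mono_mul_diagonal_hom (A : Config m n) (φ z : Config m n → ℂ)
    (hz : ∀ x y, z (x + y) = z x * z y) (hz2 : ∀ x, z x * z x = 1) :
    mono A φ * mono 0 z = z A • (mono 0 z * mono A φ) := by
  ext x y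
  rw [Matrix.smul_apply, mono_mul_mono, mono_mul_mono, mono_apply, mono_apply, hz]
  simp only [add_zero, zero_add, smul_eq_mul]
  split_ifs
  · linear_combination (-(φ y * z y)) * hz2 A
  · simp

/-! ### Pauli strings -/

/-- The sign `(-1)^a`. -/
def sgn (a : Fin 2) : ℂ := if a = 1 then -1 else 1

lemma sgn_add : ∀ a b : Fin 2, sgn (a + b) = sgn a * sgn b := by
  intro a b; fin_cases a <;> fin_cases b <;> simp [sgn]

lemma sgn_mul_self (a : Fin 2) : sgn a * sgn a = 1 := by
  unfold sgn; split_ifs <;> norm_num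

lemma sgn_zero : sgn 0 = 1 := by simp [sgn]
lemma sgn_one : sgn 1 = -1 := by simp [sgn]

lemma star_sgn (a : Fin 2) : star (sgn a) = sgn a := by
  unfold sgn; split_ifs <;> simp

lemma sgn_sum {ι : Type*} (s : Finset ι) (f : ι → Fin 2) :
    sgn (∑ i ∈ s, f i) = ∏ i ∈ s, sgn (f i) := by
  classical
  induction s using Finset.induction_on with
  | empty => simp [sgn_zero]
  | insert a s ha ih => rw [Finset.sum_insert ha, Finset.prod_insert ha, sgn_add, ih]

/-- Whether a Pauli matrix flips the computational basis states. -/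
def xBit : Fin 4 → Fin 2 := ![0, 1, 1, 0]

/-- Whether a Pauli matrix has distinct phases on the two computational basis states. -/
def zBit : Fin 4 → Fin 2 := ![0, 0, 1, 1]

/-- The phase of a Pauli matrix on a basis state. -/
def pauliPhase (v : Fin 4) (y : Fin 2) : ℂ :=
  (if v = 2 then Complex.I else 1) * if zBit v = 1 then sgn y else 1

lemma pauli_apply (v : Fin 4) (x y : Fin 2) :
    pauli v x y = if x = y + xBit v then pauliPhase v y else 0 := by
  fin_cases v <;> fin_cases x <;> fin_cases y <;> simp [pauli, xBit, pauliPhase, zBit, sgn]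

/-- The qubits that a Pauli string flips. -/
def xPart (v : Qubit m n → Fin 4) : Config m n := fun q => xBit (v q)

/-- The phase of a Pauli string on a basis state. -/
def stringPhase (v : Qubit m n → Fin 4) (y : Config m n) : ℂ := ∏ q, pauliPhase (v q) (y q)

lemma pauliString_eq_mono (v : Qubit m n → Fin 4) :
    pauliString v = mono (xPart v) (stringPhase v) := by
  ext x y
  rw [mono_apply]
  change ∏ q, pauli (v q) (x q) (y q) = _
  simp only [pauli_apply]
  split_ifs with h
  · refine Finset.prod_congr rfl fun q _ => ?_
    rw [if_pos (by rw [h]; rfl)]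
  · obtain ⟨q, hq⟩ := Function.ne_iff.1 h
    exact Finset.prod_eq_zero (Finset.mem_univ q) (if_neg hq)

/-! ### Stabilizers -/

/-- The `Z`-type operator on a set of qubits, as a phase. -/
def zPhase (Q : Finset (Qubit m n)) (y : Config m n) : ℂ := ∏ q ∈ Q, sgn (y q)

lemma zPhase_add (Q : Finset (Qubit m n)) (x y : Config m n) :
    zPhase Q (x + y) = zPhase Q x * zPhase Q y := by
  simp only [zPhase, Pi.add_apply, sgn_add, Finset.prod_mul_distrib]

lemma zPhase_mul_self (Q : Finset (Qubit m n)) (x : Config m n) :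
    zPhase Q x * zPhase Q x = 1 := by
  simp only [zPhase, ← Finset.prod_mul_distrib, sgn_mul_self, Finset.prod_const_one]

lemma zPhase_zero (Q : Finset (Qubit m n)) : zPhase Q 0 = 1 := by
  simp [zPhase, sgn_zero]

lemma star_zPhase (Q : Finset (Qubit m n)) (x : Config m n) : star (zPhase Q x) = zPhase Q x := by
  simp only [zPhase, star_prod, star_sgn]

/-- The flip of the qubits of the rows of block `b` that satisfy `p`. -/
def rowsFlip (b : Fin 3) (p : Fin m → Prop) [DecidablePred p] : Config m n :=
  fun q => if q.1 = b ∧ p q.2.1 then 1 else 0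

/-- The qubits that a stabilizer generator flips. -/
def genX : Gen m n → Config m n
  | Sum.inl _ => 0
  | Sum.inr (b, i) => rowsFlip b fun r => r.val = i.val ∨ r.val = i.val + 1

/-- The qubits on which a stabilizer generator acts by `Z`. -/
def genZ : Gen m n → Finset (Qubit m n)
  | Sum.inl (b, i, j) =>
      Finset.univ.filter fun q =>
        q.1 = b ∧ q.2.1 = i ∧ (q.2.2.val = j.val ∨ q.2.2.val = j.val + 1)
  | Sum.inr _ => ∅

lemma stabGen_eq_mono (k : Gen m n) : stabGen k = mono (genX k) (zPhase (genZ k)) := by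
  rw [stabGen, pauliString_eq_mono]
  rcases k with ⟨b, i, j⟩ | ⟨b, i⟩
  · congr 1
    · funext q
      simp only [xPart, genLabel, genX]
      split_ifs <;> rfl
    · funext y
      simp only [stringPhase, genLabel, genZ, zPhase, Finset.prod_filter]
      refine Finset.prod_congr rfl fun q _ => ?_
      split_ifs <;> simp [pauliPhase, zBit]
  · congr 1
    · funext q
      simp only [xPart, genLabel, genX, rowsFlip]
      split_ifs <;> rfl
    · funext y
      simp only [stringPhase, genLabel, genZ, zPhase, Finset.prod_empty]
      refine Finset.prod_eq_one fun q _ => ?_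
      split_ifs <;> simp [pauliPhase, zBit]

/-- The two qubits of a `Z`-type generator. -/
lemma zPhase_genZ_inl (b : Fin 3) (i : Fin m) (j : Fin (n - 1)) (x : Config m n) :
    zPhase (genZ (Sum.inl (b, i, j))) x =
      sgn (x (b, i, ⟨j, by omega⟩)) * sgn (x (b, i, ⟨j + 1, by omega⟩)) := by
  have : genZ (Sum.inl (b, i, j)) =
      {((b, i, ⟨j, by omega⟩) : Qubit m n), (b, i, ⟨j + 1, by omega⟩)} := by
    ext ⟨b', i', j'⟩
    simp only [genZ, Finset.mem_filter, Finset.mem_univ, true_and, Finset.mem_insert,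
      Finset.mem_singleton, Prod.mk.injEq, Fin.ext_iff]
    tauto
  rw [zPhase, this, Finset.prod_pair]
  simp [Fin.ext_iff]

lemma zPhase_genZ_rowsFlip (k : Gen m n) (b : Fin 3) (p : Fin m → Prop) [DecidablePred p] :
    zPhase (genZ k) (rowsFlip b p) = 1 := by
  rcases k with ⟨b', i, j⟩ | ⟨b', i⟩
  · rw [zPhase_genZ_inl]
    exact sgn_mul_self _
  · rfl

lemma zPhase_genZ_genX (k l : Gen m n) : zPhase (genZ k) (genX l) = 1 := by
  rcases l with ⟨b', i, j⟩ | ⟨b', i⟩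
  · exact zPhase_zero _
  · exact zPhase_genZ_rowsFlip k b' fun r => r.val = i.val ∨ r.val = i.val + 1

lemma mono_zPhase_commute {A B : Config m n} {Q R : Finset (Qubit m n)}
    (h1 : zPhase Q B = 1) (h2 : zPhase R A = 1) :
    Commute (mono A (zPhase Q)) (mono B (zPhase R)) := by
  rw [Commute, SemiconjBy, mono_mul_mono, mono_mul_mono, add_comm]
  congr 1
  funext y
  rw [zPhase_add, zPhase_add, h1, h2, mul_one, mul_one, mul_comm]

lemma stabGen_commute (k l : Gen m n) : Commute (stabGen k) (stabGen l) := by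
  rw [stabGen_eq_mono, stabGen_eq_mono]
  exact mono_zPhase_commute (zPhase_genZ_genX _ _) (zPhase_genZ_genX _ _)

lemma stabGen_mul_self (k : Gen m n) : stabGen k * stabGen k = 1 := by
  rw [stabGen_eq_mono, mono_mul_mono, Config.add_self, one_eq_mono]
  congr 1
  funext y
  rw [zPhase_add, zPhase_genZ_genX, mul_one, zPhase_mul_self]

lemma stabGen_conjTranspose (k : Gen m n) : (stabGen k)ᴴ = stabGen k := by
  rw [stabGen_eq_mono, mono_conjTranspose]
  congr 1
  funext y
  rw [zPhase_add, zPhase_genZ_genX, mul_one, star_zPhase]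

/-- The factor `(I ± s_k) / 2` of a syndrome projector. -/
def genProj (α : Gen m n → Fin 2) (k : Gen m n) : Op m n :=
  (2⁻¹ : ℂ) • (1 + ((-1 : ℂ) ^ (α k).val) • stabGen k)

lemma syndromeProj_eq (α : Gen m n → Fin 2) :
    syndromeProj α = ((Finset.univ : Finset (Gen m n)).toList.map (genProj α)).prod := rfl

lemma commute_genProj {T : Op m n} {k : Gen m n} (h : Commute T (stabGen k))
    (α : Gen m n → Fin 2) : Commute T (genProj α k) :=
  ((Commute.one_right T).add_right (h.smul_right _)).smul_right _

lemma commute_syndromeProj {T : Op m n} (h : ∀ k, Commute T (stabGen k)) (α : Gen m n → Fin 2) :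
    Commute T (syndromeProj α) := by
  rw [syndromeProj_eq]
  refine Commute.list_prod_right _ _ fun z hz => ?_
  obtain ⟨k, -, rfl⟩ := List.mem_map.1 hz
  exact commute_genProj (h k) α

lemma genProj_commute (α : Gen m n → Fin 2) (k l : Gen m n) :
    Commute (genProj α k) (genProj α l) :=
  commute_genProj (commute_genProj (stabGen_commute l k) α).symm α

lemma genProj_conjTranspose (α : Gen m n → Fin 2) (k : Gen m n) :
    (genProj α k)ᴴ = genProj α k := by
  simp [genProj, Matrix.conjTranspose_smul, Matrix.conjTranspose_add, stabGen_conjTranspose]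

lemma syndromeProj_conjTranspose (α : Gen m n → Fin 2) :
    (syndromeProj α)ᴴ = syndromeProj α := by
  rw [syndromeProj_eq, Matrix.conjTranspose_list_prod, List.map_map]
  have : (conjTranspose ∘ genProj α) = genProj (m := m) (n := n) α :=
    funext fun k => genProj_conjTranspose α k
  rw [this]
  refine (List.reverse_perm _).prod_eq' ?_
  rw [List.pairwise_reverse, List.pairwise_map]
  exact List.pairwise_of_forall fun k l => genProj_commute α l k

lemma codeProj_eq : codeProj m n = syndromeProj fun _ => 0 := rfl

lemma codeProj_conjTranspose : (codeProj m n)ᴴ = codeProj m n := syndromeProj_conjTranspose _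

lemma stabGen_mul_codeProj (k : Gen m n) : stabGen k * codeProj m n = codeProj m n := by
  rw [codeProj_eq, syndromeProj_eq]
  have hk : k ∈ (Finset.univ : Finset (Gen m n)).toList := by simp
  generalize (Finset.univ : Finset (Gen m n)).toList = l at hk
  induction l with
  | nil => simp at hk
  | cons k' l ih =>
    rw [List.map_cons, List.prod_cons, ← mul_assoc]
    rcases List.mem_cons.1 hk with rfl | hk
    · congr 1
      simp only [genProj, Fin.val_zero, pow_zero, one_smul, mul_smul_comm, mul_add, mul_one,
        stabGen_mul_self]
      rw [add_comm]
    · rw [(commute_genProj (stabGen_commute k k') _).eq, mul_assoc, ih hk]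

lemma codeProj_mul_stabGen (k : Gen m n) : codeProj m n * stabGen k = codeProj m n := by
  rw [codeProj_eq, ← (commute_syndromeProj (stabGen_commute k) _).eq]
  exact stabGen_mul_codeProj k

lemma codeProj_mul_self : codeProj m n * codeProj m n = codeProj m n := by
  nth_rw 1 [codeProj_eq]
  rw [syndromeProj_eq]
  generalize (Finset.univ : Finset (Gen m n)).toList = l
  induction l with
  | nil => simp
  | cons k l ih =>
    rw [List.map_cons, List.prod_cons, mul_assoc, ih]
    simp only [genProj, Fin.val_zero, pow_zero, one_smul, smul_mul_assoc, add_mul, one_mul,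
      stabGen_mul_codeProj, ← two_smul ℂ (codeProj m n), smul_smul]
    norm_num

-- Each factor `(I + s_k) / 2` has nonnegative entries and a positive entry at `(0, 0)`, and both
-- properties survive products. The entry serves to normalise multiples of `P`.
open ComplexOrder in
lemma codeProj_zero_zero_pos : 0 < codeProj m n 0 0 := by
  suffices h : ∀ l : List (Gen m n), (∀ x y, 0 ≤ (l.map (genProj fun _ => 0)).prod x y) ∧
      0 < (l.map (genProj fun _ => 0)).prod 0 0 from (h _).2
  have hk : ∀ k : Gen m n, (∀ x y, 0 ≤ genProj (fun _ => 0) k x y) ∧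
      0 < genProj (fun _ => 0) k 0 0 := by
    intro k
    have h2 : (0 : ℂ) < 2⁻¹ := by norm_num
    rcases k with ⟨b, i, j⟩ | ⟨b, i⟩
    · have hs : ∀ x, zPhase (genZ (Sum.inl (b, i, j))) x = 1 ∨
          zPhase (genZ (Sum.inl (b, i, j))) x = -1 := fun x =>
        mul_self_eq_one_iff.1 (zPhase_mul_self (m := m) (n := n) _ x)
      refine ⟨fun x y => ?_, ?_⟩
      · simp only [genProj, stabGen_eq_mono, Matrix.smul_apply, Matrix.add_apply, one_eq_mono,
          mono_apply, genX, add_zero, Fin.val_zero, pow_zero, one_smul, smul_eq_mul]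
        refine mul_nonneg h2.le ?_
        split_ifs
        · rcases hs y with h | h <;> rw [h] <;> norm_num
        · simp
      · simp only [genProj, stabGen_eq_mono, Matrix.smul_apply, Matrix.add_apply, one_eq_mono,
          mono_apply, genX, add_zero, Fin.val_zero, pow_zero, one_smul, smul_eq_mul, zPhase_zero]
        refine mul_pos h2 ?_
        norm_num
    · refine ⟨fun x y => ?_, ?_⟩
      · simp only [genProj, stabGen_eq_mono, Matrix.smul_apply, Matrix.add_apply, one_eq_mono,
          mono_apply, genZ, zPhase, Finset.prod_empty, Fin.val_zero, pow_zero, one_smul,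
          smul_eq_mul]
        refine mul_nonneg h2.le (add_nonneg ?_ ?_) <;> split_ifs <;> norm_num
      · simp only [genProj, stabGen_eq_mono, Matrix.smul_apply, Matrix.add_apply, one_eq_mono,
          mono_apply, genZ, zPhase, Finset.prod_empty, Fin.val_zero, pow_zero, one_smul,
          smul_eq_mul]
        refine mul_pos h2 (add_pos_of_pos_of_nonneg ?_ ?_)
        · norm_num
        · split_ifs <;> norm_num
  intro l
  induction l with
  | nil =>
    refine ⟨fun x y => ?_, by simp⟩
    rw [List.map_nil, List.prod_nil, Matrix.one_apply]
    split_ifs <;> norm_num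
  | cons k l ih =>
    rw [List.map_cons, List.prod_cons]
    refine ⟨fun x y => ?_, ?_⟩
    · rw [Matrix.mul_apply]
      exact Finset.sum_nonneg fun u _ => mul_nonneg ((hk k).1 _ _) (ih.1 _ _)
    · rw [Matrix.mul_apply]
      exact Finset.sum_pos' (fun u _ => mul_nonneg ((hk k).1 _ _) (ih.1 _ _))
        ⟨0, Finset.mem_univ _, mul_pos (hk k).2 ih.2⟩

open ComplexOrder in
lemma codeProj_zero_zero_ne_zero : codeProj m n 0 0 ≠ 0 := codeProj_zero_zero_pos.ne'

/-! ### Operators that act as scalars on the code -/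

lemma exists_adjacent_ne {N : ℕ} {α : Type*} (G : Fin N → α) {j j' : Fin N} (h : G j ≠ G j') :
    ∃ k : Fin (N - 1), G ⟨k, by omega⟩ ≠ G ⟨k + 1, by omega⟩ := by
  by_contra! hc
  have key : ∀ (k : ℕ) (hk : k < N), G ⟨k, hk⟩ = G ⟨0, by omega⟩ := by
    intro k
    induction k with
    | zero => intro _; rfl
    | succ k ih =>
      intro hk
      rw [← ih (by omega)]
      exact (hc ⟨k, by omega⟩).symm
  exact h ((key j j.2).trans (key j' j'.2).symm)

lemma fin_two_eq_one {a : Fin 2} (h : a ≠ 0) : a = 1 := by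
  revert a; decide

lemma sgn_mul_sgn_of_ne {a b : Fin 2} (h : a ≠ b) : sgn a * sgn b = -1 := by
  fin_cases a <;> fin_cases b <;> simp_all [sgn]

/-- A basis state in which every row is constant. -/
def RowConst (x : Config m n) : Prop := ∀ b i j j', x (b, i, j) = x (b, i, j')

lemma exists_genZ_of_not_rowConst {x : Config m n} (h : ¬ RowConst x) :
    ∃ k : Gen m n, genX k = 0 ∧ zPhase (genZ k) x = -1 := by
  simp only [RowConst, not_forall] at h
  obtain ⟨b, i, j, j', h⟩ := h
  obtain ⟨k, hk⟩ := exists_adjacent_ne (fun j => x (b, i, j)) h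
  exact ⟨Sum.inl (b, i, k), rfl, by rw [zPhase_genZ_inl, sgn_mul_sgn_of_ne hk]⟩

/-- The flip of a row, i.e. the operator `X_{i,*}` of block `b`. -/
abbrev rowFlip (b : Fin 3) (i : Fin m) : Config m n := rowsFlip b (· = i)

/-- The operator that flips the qubits of `A`. -/
def xOp (A : Config m n) : Op m n := mono A fun _ => 1

/-- The `Z`-type operator on a set of qubits. -/
def zOp (Q : Finset (Qubit m n)) : Op m n := mono 0 (zPhase Q)

/-- A column of a block. -/
def col (b : Fin 3) (j : Fin n) : Finset (Qubit m n) := Finset.univ.image fun i => (b, i, j)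

lemma zPhase_col (b : Fin 3) (j : Fin n) (x : Config m n) :
    zPhase (col b j) x = sgn (∑ i, x (b, i, j)) := by
  rw [zPhase, col, Finset.prod_image (by intro i _ i' _ h; simpa using h), sgn_sum]

/-- Operators that are fixed by the stabilizers and commute with a logical `X` operator, on row
`i b`, and a logical `Z` operator, on column `j`, of each block `b`. -/
structure IsScalarOnCode (i : Fin 3 → Fin m) (j : Fin n) (M : Op m n) : Prop where
  left : ∀ k, stabGen k * M = M
  right : ∀ k, M * stabGen k = M
  logicalX : ∀ b, Commute (xOp (rowFlip b (i b))) M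
  logicalZ : ∀ b, Commute (zOp (col b j)) M

lemma xOp_rowsFlip_commute (b : Fin 3) (p : Fin m → Prop) [DecidablePred p] (k : Gen m n) :
    Commute (xOp (rowsFlip b p)) (stabGen k) := by
  rw [stabGen_eq_mono, xOp, Commute, SemiconjBy, mono_mul_mono, mono_mul_mono, add_comm]
  congr 1
  funext y
  simp only [zPhase_add, zPhase_genZ_rowsFlip, one_mul, mul_one]

/-- An `X`-type generator flips two rows, hence either two qubits of the column or none. -/
lemma zOp_col_commute (b : Fin 3) (j : Fin n) (k : Gen m n) :
    Commute (zOp (col b j)) (stabGen k) := by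
  rw [stabGen_eq_mono, zOp]
  refine mono_zPhase_commute ?_ (zPhase_zero _)
  rw [zPhase_col]
  rcases k with ⟨b', i, j'⟩ | ⟨b', i⟩
  · simp [genX, sgn]
  · by_cases hb : b = b'
    · subst hb
      have h1 : ∑ x : Fin m, (genX (Sum.inr (b, i)) : Config m n) (b, x, j) =
          ∑ x : Fin m, ((if x = ⟨i, by omega⟩ then (1 : Fin 2) else 0) +
            if x = ⟨i + 1, by omega⟩ then 1 else 0) := by
        refine Finset.sum_congr rfl fun x _ => ?_
        simp only [genX, rowsFlip, Fin.ext_iff, true_and]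
        by_cases h1 : x.val = i.val
        · simp [h1]
        · simp [h1]
      rw [h1, Finset.sum_add_distrib]
      simp [sgn]
    · have : ∀ x : Fin m, (genX (Sum.inr (b', i)) : Config m n) (b, x, j) = 0 := by
        intro x
        simp [genX, rowsFlip, hb]
      simp [this, sgn]

lemma isScalarOnCode_codeProj (i : Fin 3 → Fin m) (j : Fin n) :
    IsScalarOnCode i j (codeProj m n) where
  left := stabGen_mul_codeProj
  right := codeProj_mul_stabGen
  logicalX b := commute_syndromeProj (xOp_rowsFlip_commute b _) _
  logicalZ b := commute_syndromeProj (zOp_col_commute b j) _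

/-- The translations that leave a matrix invariant. -/
def translations (M : Op m n) : AddSubgroup (Config m n × Config m n) where
  carrier := {u | ∀ x y, M (x + u.1) (y + u.2) = M x y}
  zero_mem' x y := by simp
  add_mem' {u v} hu hv x y := by
    simp only [Set.mem_ofPred_eq, Prod.fst_add, Prod.snd_add] at *
    rw [← add_assoc, ← add_assoc, hv, hu]
  neg_mem' {u} hu x y := by
    have : -u = u := neg_eq_of_add_eq_zero_left
      (Prod.ext (Config.add_self _) (Config.add_self _))
    rw [this]
    exact hu x y

lemma genX_inr (b : Fin 3) (r : Fin (m - 1)) :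
    (genX (Sum.inr (b, r)) : Config m n) =
      rowFlip b ⟨r, by omega⟩ + rowFlip b ⟨r + 1, by omega⟩ := by
  funext q
  simp only [genX, rowsFlip, Pi.add_apply, Fin.ext_iff]
  by_cases h0 : q.1 = b <;> by_cases h1 : q.2.1.val = r.val <;> simp [h0, h1]

/-- A subgroup that contains the sums of adjacent rows contains the sums of all pairs of rows. -/
lemma rowFlip_add_rowFlip_mem {G : Type*} [AddCommGroup G] (H : AddSubgroup G)
    (φ : Config m n →+ G) (hH : ∀ k : Gen m n, φ (genX k) ∈ H) (b : Fin 3) (r r' : Fin m) :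
    φ (rowFlip b r + rowFlip b r') ∈ H := by
  have key : ∀ (k : ℕ) (hk : k < m),
      φ (rowFlip b ⟨0, by omega⟩ + rowFlip b ⟨k, hk⟩) ∈ H := by
    intro k
    induction k with
    | zero => intro _; rw [Config.add_self, map_zero]; exact H.zero_mem
    | succ k ih =>
      intro hk
      have h1 := H.add_mem (ih (by omega)) (hH (Sum.inr (b, ⟨k, by omega⟩)))
      rwa [← map_add, genX_inr, ← add_assoc, Config.add_add_cancel] at h1
  have h1 := H.add_mem (key r r.2) (key r' r'.2)
  rwa [← map_add, add_comm (rowFlip b _), add_assoc, ← add_assoc (rowFlip b ⟨0, _⟩),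
    Config.add_self, zero_add] at h1

lemma RowConst.eq_sum {x : Config m n} (h : RowConst x) (j : Fin n) :
    x = ∑ b, ∑ r, if x (b, r, j) = 1 then rowFlip b r else 0 := by
  funext ⟨b, r, j'⟩
  simp only [Finset.sum_apply]
  rw [Finset.sum_eq_single b, Finset.sum_eq_single r]
  · rw [h b r j' j]
    split_ifs with h1
    · simp [rowsFlip, h1]
    · by_contra h2
      exact h1 (fin_two_eq_one h2)
  · intro r' _ hr
    split_ifs
    · simp [rowsFlip, hr.symm]
    · rfl
  · simp
  · intro b' _ hb
    refine Finset.sum_eq_zero fun r' _ => ?_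
    split_ifs
    · simp [rowsFlip, hb.symm]
    · rfl
  · simp

/-- A row-constant basis state of even parity in each block is a sum of pairs of rows. -/
lemma RowConst.eq_sum_pairs {x : Config m n} (h : RowConst x) (j : Fin n)
    (hpar : ∀ b, ∑ r, x (b, r, j) = 0) (r₀ : Fin m) :
    x = ∑ b, ∑ r, if x (b, r, j) = 1 then rowFlip b r + rowFlip b r₀ else 0 := by
  have h1 : ∀ b r, (if x (b, r, j) = 1 then rowFlip b r + rowFlip b r₀ else 0 : Config m n) =
      (if x (b, r, j) = 1 then rowFlip b r else 0) +
        (if x (b, r, j) = 1 then rowFlip b r₀ else 0) := by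
    intro b r; split_ifs <;> simp
  -- By parity the auxiliary row `r₀` is flipped an even number of times.
  have h2 : ∀ b, (∑ r, if x (b, r, j) = 1 then rowFlip b r₀ else 0 : Config m n) = 0 := by
    intro b
    funext q
    simp only [Finset.sum_apply, Pi.zero_apply]
    by_cases hq : q.1 = b ∧ q.2.1 = r₀
    · rw [← hpar b]
      refine Finset.sum_congr rfl fun r _ => ?_
      split_ifs with h3
      · rw [h3]; simp [rowsFlip, hq]
      · by_contra h4
        exact h3 (fin_two_eq_one (Ne.symm h4))
    · refine Finset.sum_eq_zero fun r _ => ?_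
      split_ifs
      · simp [rowsFlip, hq]
      · rfl
  simp only [h1, Finset.sum_add_distrib, h2, add_zero]
  simpa using h.eq_sum j

lemma IsScalarOnCode.genX_mem_left {i : Fin 3 → Fin m} {j : Fin n} {M : Op m n}
    (hM : IsScalarOnCode i j M) (k : Gen m n) :
    AddMonoidHom.inl (Config m n) (Config m n) (genX k) ∈ translations M := by
  rcases k with ⟨b, r, j⟩ | ⟨b, r⟩
  · exact (translations M).zero_mem
  · intro x y
    have := congrFun (congrFun (hM.left (Sum.inr (b, r))) x) y
    rw [stabGen_eq_mono, mono_mul_apply] at this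
    simpa [genZ, zPhase] using this

lemma IsScalarOnCode.genX_mem_right {i : Fin 3 → Fin m} {j : Fin n} {M : Op m n}
    (hM : IsScalarOnCode i j M) (k : Gen m n) :
    AddMonoidHom.inr (Config m n) (Config m n) (genX k) ∈ translations M := by
  rcases k with ⟨b, r, j⟩ | ⟨b, r⟩
  · exact (translations M).zero_mem
  · intro x y
    have := congrFun (congrFun (hM.right (Sum.inr (b, r))) x) y
    rw [stabGen_eq_mono, mul_mono_apply] at this
    simpa [genZ, zPhase] using this

/-- The logical `X` gives this for row `i b`; invariance under pairs of rows, on the left and on the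
right separately, carries it to every other row. -/
lemma IsScalarOnCode.rowFlip_mem {i : Fin 3 → Fin m} {j : Fin n} {M : Op m n}
    (hM : IsScalarOnCode i j M) (b : Fin 3) (r : Fin m) :
    (rowFlip b r, rowFlip b r) ∈ translations M := by
  have h0 : (rowFlip b (i b), rowFlip b (i b)) ∈ translations M := by
    intro x y
    have := congrFun (congrFun (hM.logicalX b).eq x) (y + rowFlip b (i b))
    rw [xOp, mono_mul_apply, mul_mono_apply, Config.add_add_cancel] at this
    simpa using this
  have h1 := rowFlip_add_rowFlip_mem (translations M) (AddMonoidHom.inl _ _) hM.genX_mem_left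
    b r (i b)
  have h2 := rowFlip_add_rowFlip_mem (translations M) (AddMonoidHom.inr _ _) hM.genX_mem_right
    b r (i b)
  have h3 := (translations M).add_mem ((translations M).add_mem h1 h2) h0
  simpa [Config.add_add_cancel] using h3

lemma IsScalarOnCode.eq_zero_left {i : Fin 3 → Fin m} {j : Fin n} {M : Op m n}
    (hM : IsScalarOnCode i j M) {x : Config m n} (hx : ¬ RowConst x) (y : Config m n) :
    M x y = 0 := by
  obtain ⟨k, hk, hk'⟩ := exists_genZ_of_not_rowConst hx
  have := congrFun (congrFun (hM.left k) x) y
  rw [stabGen_eq_mono, mono_mul_apply, hk, add_zero, hk'] at this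
  linear_combination (-1 / 2 : ℂ) * this

lemma IsScalarOnCode.eq_zero_right {i : Fin 3 → Fin m} {j : Fin n} {M : Op m n}
    (hM : IsScalarOnCode i j M) (x : Config m n) {y : Config m n} (hy : ¬ RowConst y) :
    M x y = 0 := by
  obtain ⟨k, hk, hk'⟩ := exists_genZ_of_not_rowConst hy
  have := congrFun (congrFun (hM.right k) x) y
  rw [stabGen_eq_mono, mul_mono_apply, hk, add_zero, hk'] at this
  linear_combination (-1 / 2 : ℂ) * this

lemma IsScalarOnCode.translation_mem {i : Fin 3 → Fin m} {j : Fin n} {M : Op m n}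
    (hM : IsScalarOnCode i j M) {x : Config m n} (hx : RowConst x) :
    (x, x) ∈ translations M := by
  have h1 : (x, x) = ∑ b, ∑ r, if x (b, r, j) = 1 then
      ((rowFlip b r, rowFlip b r) : Config m n × Config m n) else 0 := by
    have h2 : ∀ b r, (if x (b, r, j) = 1 then
        ((rowFlip b r, rowFlip b r) : Config m n × Config m n) else 0) =
        (AddMonoidHom.prod (AddMonoidHom.id _) (AddMonoidHom.id _))
          (if x (b, r, j) = 1 then rowFlip b r else 0) := by
      intro b r; split_ifs <;> rfl
    simp only [h2, ← map_sum]
    rw [← hx.eq_sum j]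
    rfl
  rw [h1]
  refine sum_mem fun b _ => sum_mem fun r _ => ?_
  split_ifs
  · exact hM.rowFlip_mem b r
  · exact (translations M).zero_mem

/-- The alternative depends on the position and not on `M`, so `M` is determined by `M 0 0` and can
be compared with `P`. A `ZZ` generator kills entries off the row-constant states, and the logical
`X` operators move the rest to `(0, u)`. There, a logical `Z` kills the entry if some block of `u`
has odd parity, and otherwise `u` is a sum of stabilizer flips. -/
lemma IsScalarOnCode.apply_eq_or (i : Fin 3 → Fin m) (j : Fin n) (x y : Config m n) :
    (∀ M, IsScalarOnCode i j M → M x y = 0) ∨ (∀ M, IsScalarOnCode i j M → M x y = M 0 0) := by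
  by_cases hx : RowConst x
  swap
  · exact Or.inl fun M hM => hM.eq_zero_left hx y
  by_cases hy : RowConst y
  swap
  · exact Or.inl fun M hM => hM.eq_zero_right x hy
  have h1 : ∀ M, IsScalarOnCode i j M → M x y = M 0 (y + x) := fun M hM => by
    rw [← hM.translation_mem hx x y, Config.add_self]
  have hu : RowConst (y + x) := fun b r j j' => by
    rw [Pi.add_apply, Pi.add_apply, hx b r j j', hy b r j j']
  generalize y + x = u at h1 hu
  by_cases hpar : ∀ b, ∑ r, u (b, r, j) = 0
  · refine Or.inr fun M hM => (h1 M hM).trans ?_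
    have h2 : AddMonoidHom.inr (Config m n) (Config m n) u ∈ translations M := by
      rw [hu.eq_sum_pairs j hpar (i 0), map_sum]
      refine sum_mem fun b _ => ?_
      rw [map_sum]
      refine sum_mem fun r _ => ?_
      split_ifs
      · exact rowFlip_add_rowFlip_mem _ _ hM.genX_mem_right _ _ _
      · rw [map_zero]; exact zero_mem _
    simpa using h2 0 0
  · push Not at hpar
    obtain ⟨b, hb⟩ := hpar
    refine Or.inl fun M hM => (h1 M hM).trans ?_
    have h2 := congrFun (congrFun (hM.logicalZ b).eq 0) u
    rw [zOp, mono_mul_apply, mul_mono_apply, add_zero, add_zero, zPhase_zero, zPhase_col,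
      fin_two_eq_one hb, sgn_one] at h2
    linear_combination (1 / 2 : ℂ) * h2

lemma IsScalarOnCode.eq_smul {i : Fin 3 → Fin m} {j : Fin n} {M : Op m n}
    (hM : IsScalarOnCode i j M) : M = (M 0 0 / codeProj m n 0 0) • codeProj m n := by
  have h0 : codeProj m n 0 0 ≠ 0 := codeProj_zero_zero_ne_zero
  ext x y
  rw [Matrix.smul_apply, smul_eq_mul]
  rcases IsScalarOnCode.apply_eq_or i j x y with h | h
  · rw [h M hM, h _ (isScalarOnCode_codeProj i j), mul_zero]
  · rw [h M hM, h _ (isScalarOnCode_codeProj i j), div_mul_cancel₀ _ h0]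

/-! ### Propagated errors as monomial operators -/

/-- The phase of a CCZ gate on a basis state. -/
def gatePhase (g : CCZGate m n) (y : Config m n) : ℂ := if ∀ b, y (b, g b) = 1 then -1 else 1

lemma gatePhase_mul_self (g : CCZGate m n) (y : Config m n) :
    gatePhase g y * gatePhase g y = 1 := by
  unfold gatePhase; split_ifs <;> norm_num

lemma star_gatePhase (g : CCZGate m n) (y : Config m n) :
    star (gatePhase g y) = gatePhase g y := by
  unfold gatePhase; split_ifs <;> simp

lemma gatePhase_congr {g : CCZGate m n} {x y : Config m n} (h : ∀ b, x (b, g b) = y (b, g b)) :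
    gatePhase g x = gatePhase g y := by
  simp only [gatePhase, h]

/-- The list is increasing, so the shifts already applied when `t` acts are those with `s < t`. The
sum over `s < t` has the advantage of being unchanged when a last timestep is appended. -/
lemma foldl_mono {d : ℕ} (a : Fin d → Config m n) (φ : Fin d → Config m n → ℂ)
    (l : List (Fin d)) (hl : l.Pairwise (· < ·)) :
    l.foldl (fun A t => mono (a t) (φ t) * A) 1 =
      mono (l.map a).sum fun y =>
        (l.map fun t => φ t (y + (l.map fun s => if s < t then a s else 0).sum)).prod := by
  induction l using List.reverseRecOn with
  | nil => simp [one_eq_mono]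
  | append_singleton l u ih =>
    rw [List.pairwise_append] at hl
    rw [List.foldl_append, ih hl.1, List.foldl_cons, List.foldl_nil, mono_mul_mono]
    have hu : (l.map fun s => if s < u then a s else 0) = l.map a :=
      List.map_congr_left fun s hs => if_pos (hl.2.2 s hs u (by simp))
    congr 1
    · simp [add_comm]
    · funext y
      simp only [List.map_append, List.map_cons, List.map_nil, List.sum_append, List.sum_cons,
        List.sum_nil, List.prod_append, List.prod_cons, List.prod_nil, hu, lt_irrefl, if_false,
        add_zero, mul_one]
      rw [mul_comm]
      congr 2
      refine List.map_congr_left fun t ht => ?_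
      rw [if_neg (not_lt.2 (hl.2.2 t ht u (by simp)).le), add_zero]

lemma foldl_mono_finRange {d : ℕ} (a : Fin d → Config m n) (φ : Fin d → Config m n → ℂ) :
    (List.finRange d).foldl (fun A t => mono (a t) (φ t) * A) 1 =
      mono (∑ t, a t) fun y => ∏ t, φ t (y + ∑ s, if s < t then a s else 0) := by
  rw [foldl_mono _ _ _ (List.pairwise_lt_finRange d)]
  simp only [Fin.sum_univ_def, Fin.prod_univ_def]

namespace CCZCircuit

variable (C : CCZCircuit m n)

/-- The phase of a timestep on a basis state. -/
def stepPhase (t : Fin C.depth) (y : Config m n) : ℂ := ∏ g ∈ C.step t, gatePhase g y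

lemma stepUnitary_eq_mono (t : Fin C.depth) : C.stepUnitary t = mono 0 (C.stepPhase t) :=
  diagonal_eq_mono _

variable {C}

/-- The qubits flipped by the errors before timestep `t`. -/
def frameBefore (f : C.ErrorPattern) (t : Fin C.depth) : Config m n :=
  ∑ s, if s < t then xPart (f s) else 0

/-- The qubits flipped by all the errors. -/
def frame (f : C.ErrorPattern) : Config m n := ∑ t, xPart (f t)

/-- The phase of the propagated errors on a basis state. -/
def framePhase (f : C.ErrorPattern) (y : Config m n) : ℂ :=
  ∏ t, stringPhase (f t) (y + frameBefore f t) *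
    (C.stepPhase t (y + frameBefore f t) * C.stepPhase t y)

/-- The gates do not move basis states, so only the errors contribute to the shift, and the inverse
ideal circuit contributes the unshifted phase of each timestep. -/
lemma propagated_eq_mono (f : C.ErrorPattern) :
    C.propagated f = mono (frame f) (framePhase f) := by
  have h1 : C.run f = mono (frame f) fun y => ∏ t, stringPhase (f t) (y + frameBefore f t) *
      C.stepPhase t (y + frameBefore f t) := by
    rw [run, frame]
    simp only [pauliString_eq_mono, stepUnitary_eq_mono, mono_mul_mono, add_zero]
    exact foldl_mono_finRange _ fun t y => stringPhase (f t) y * C.stepPhase t y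
  have h2 : C.ideal = mono 0 fun y => ∏ t, C.stepPhase t y := by
    rw [ideal]
    simp only [stepUnitary_eq_mono]
    rw [foldl_mono_finRange (fun _ => 0) C.stepPhase]
    simp
  rw [propagated, h1, h2, mono_conjTranspose, mono_mul_mono]
  congr 1
  · rw [add_zero]
  · funext y
    simp only [add_zero, star_prod, stepPhase, star_gatePhase, framePhase,
      ← Finset.prod_mul_distrib, mul_assoc]

/-! ### Error events -/

lemma mem_supp {g : CCZGate m n} {q : Qubit m n} : q ∈ supp g ↔ q.2 = g q.1 := by
  rcases q with ⟨b, x⟩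
  simp [supp, eq_comm]

lemma mem_supp_mk {g : CCZGate m n} {b : Fin 3} {x : Fin m × Fin n} :
    (b, x) ∈ supp g ↔ x = g b := mem_supp

lemma eq_of_mem_supp {t : Fin C.depth} {g h : CCZGate m n} (hg : g ∈ C.step t)
    (hh : h ∈ C.step t) {q : Qubit m n} (hq : q ∈ supp g) (hq' : q ∈ supp h) : g = h := by
  by_contra hne
  exact Finset.disjoint_left.1 (C.disjoint_supp t g hg h hh hne) hq hq'

lemma mem_gateSupports {t : Fin C.depth} {s : Finset (Qubit m n)} :
    s ∈ C.gateSupports t ↔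
      (∃ g ∈ C.step t, supp g = s) ∨ ∃ q, (∀ g ∈ C.step t, q ∉ supp g) ∧ {q} = s := by
  simp [gateSupports]

lemma supp_mem_gateSupports {t : Fin C.depth} {g : CCZGate m n} (hg : g ∈ C.step t) :
    supp g ∈ C.gateSupports t := mem_gateSupports.2 (Or.inl ⟨g, hg, rfl⟩)

lemma exists_mem_gateSupports (t : Fin C.depth) (q : Qubit m n) :
    ∃ s ∈ C.gateSupports t, q ∈ s := by
  by_cases h : ∃ g ∈ C.step t, q ∈ supp g
  · obtain ⟨g, hg, hq⟩ := h
    exact ⟨_, supp_mem_gateSupports hg, hq⟩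
  · push Not at h
    exact ⟨{q}, mem_gateSupports.2 (Or.inr ⟨q, h, rfl⟩), by simp⟩

lemma eq_of_mem_gateSupports {t : Fin C.depth} {s s' : Finset (Qubit m n)}
    (hs : s ∈ C.gateSupports t) (hs' : s' ∈ C.gateSupports t) {q : Qubit m n} (hq : q ∈ s)
    (hq' : q ∈ s') : s = s' := by
  rcases mem_gateSupports.1 hs with ⟨g, hg, rfl⟩ | ⟨q₁, h₁, rfl⟩ <;>
    rcases mem_gateSupports.1 hs' with ⟨g', hg', rfl⟩ | ⟨q₂, h₂, rfl⟩
  · rw [eq_of_mem_supp hg hg' hq hq']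
  · rw [Finset.mem_singleton] at hq'
    exact absurd (hq' ▸ hq) (h₂ g hg)
  · rw [Finset.mem_singleton] at hq
    exact absurd (hq ▸ hq') (h₁ g' hg')
  · rw [Finset.mem_singleton] at hq hq'
    rw [← hq, ← hq']

/-- A gate has at most one qubit in each block. -/
lemma eq_of_fst_eq {t : Fin C.depth} {s : Finset (Qubit m n)} (hs : s ∈ C.gateSupports t)
    {q q' : Qubit m n} (hq : q ∈ s) (hq' : q' ∈ s) (h : q.1 = q'.1) : q = q' := by
  rcases mem_gateSupports.1 hs with ⟨g, hg, rfl⟩ | ⟨q₁, h₁, rfl⟩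
  · rw [mem_supp] at hq hq'
    exact Prod.ext h (by rw [hq, hq', h])
  · rw [Finset.mem_singleton] at hq hq'
    rw [hq, hq']

/-- The failing gates of an error pattern. -/
def events (f : C.ErrorPattern) : Finset (Fin C.depth × Finset (Qubit m n)) :=
  Finset.univ.filter fun e => e.2 ∈ C.gateSupports e.1 ∧ ∃ q ∈ e.2, f e.1 q ≠ 0

lemma mem_events {f : C.ErrorPattern} {e : Fin C.depth × Finset (Qubit m n)} :
    e ∈ events f ↔ e.2 ∈ C.gateSupports e.1 ∧ ∃ q ∈ e.2, f e.1 q ≠ 0 := by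
  simp [events]

lemma exists_event {f : C.ErrorPattern} {t : Fin C.depth} {q : Qubit m n} (h : f t q ≠ 0) :
    ∃ s, q ∈ s ∧ (t, s) ∈ events f := by
  obtain ⟨s, hs, hq⟩ := exists_mem_gateSupports t q
  exact ⟨s, hq, mem_events.2 ⟨hs, q, hq, h⟩⟩

lemma one_le_card_of_mem_gateSupports {t : Fin C.depth} {s : Finset (Qubit m n)}
    (hs : s ∈ C.gateSupports t) : 1 ≤ s.card := by
  rcases mem_gateSupports.1 hs with ⟨g, hg, rfl⟩ | ⟨q₁, h₁, rfl⟩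
  · exact Finset.card_pos.2 ⟨(0, g 0), mem_supp.2 rfl⟩
  · simp

/-- One factor `ε` per failing gate; the remaining factor is continuous in `ε` and nonzero at `0`.
-/
lemma amplitude_isTheta (f : C.ErrorPattern) :
    (C.amplitude f) =Θ[𝓝[>] (0 : ℝ)] fun ε : ℝ => ε ^ (events f).card := by
  classical
  have h1 : ∀ ε, C.amplitude f ε = ε ^ (events f).card *
      ∏ t, ∏ s ∈ C.gateSupports t,
        if ∃ q ∈ s, f t q ≠ 0 then 1 / Real.sqrt (4 ^ s.card - 1) else Real.sqrt (1 - ε ^ 2) := by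
    intro ε
    have h2 : ε ^ (events f).card =
        ∏ t, ∏ s ∈ C.gateSupports t, if ∃ q ∈ s, f t q ≠ 0 then ε else 1 := by
      rw [← Finset.prod_const, events, Finset.prod_filter, ← Finset.univ_product_univ,
        Finset.prod_product]
      refine Finset.prod_congr rfl fun t _ => ?_
      rw [← Finset.prod_subset (Finset.subset_univ (C.gateSupports t))]
      · refine Finset.prod_congr rfl fun s hs => ?_
        simp only [hs, true_and]
      · intro s _ hs
        simp only [hs, false_and, if_false]
    rw [h2, amplitude]
    simp only [← Finset.prod_mul_distrib]
    refine Finset.prod_congr rfl fun t _ => Finset.prod_congr rfl fun s _ => ?_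
    split_ifs
    · ring
    · ring
  rw [show C.amplitude f = _ from funext h1]
  set G : ℝ → ℝ := fun ε => ∏ t, ∏ s ∈ C.gateSupports t,
    if ∃ q ∈ s, f t q ≠ 0 then 1 / Real.sqrt (4 ^ s.card - 1) else Real.sqrt (1 - ε ^ 2) with hG
  have hc : Continuous G := by
    refine continuous_finsetProd _ fun t _ => continuous_finsetProd _ fun s _ => ?_
    split_ifs
    · exact continuous_const
    · fun_prop
  have h0 : G 0 ≠ 0 := by
    refine Finset.prod_ne_zero_iff.2 fun t _ => Finset.prod_ne_zero_iff.2 fun s hs => ?_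
    split_ifs
    · have h4 : (4 : ℝ) ^ 1 ≤ 4 ^ s.card :=
        pow_le_pow_right₀ (by norm_num) (one_le_card_of_mem_gateSupports hs)
      have : 0 < Real.sqrt (4 ^ s.card - 1) := Real.sqrt_pos.2 (by linarith)
      positivity
    · simp
  have h3 : G =Θ[𝓝[>] (0 : ℝ)] fun _ => (1 : ℝ) := by
    refine (isTheta_of_div_tendsto_nhds_ne_zero (c := G 0) ?_ h0).symm
    simpa using! (hc.tendsto 0).mono_left nhdsWithin_le_nhds
  have h5 := (isTheta_refl (fun ε : ℝ => ε ^ (events f).card) (𝓝[>] (0 : ℝ))).mul h3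
  simp only [mul_one] at h5
  exact h5

lemma kraus_sandwich (f f' : C.ErrorPattern) (ε : ℝ) (T : Op m n) :
    codeProj m n * (C.kraus ε f)ᴴ * T * C.kraus ε f' * codeProj m n =
      ((C.amplitude f ε * C.amplitude f' ε : ℝ) : ℂ) •
        (codeProj m n * (C.propagated f)ᴴ * T * C.propagated f' * codeProj m n) := by
  simp only [kraus, Matrix.conjTranspose_smul, mul_smul_comm, smul_mul_assoc, smul_smul]
  simp [mul_comm]

end CCZCircuit

/-! ### A bound on the number of touched rows -/

/-- The members of a family of sets of size at most two cover at most as many points as there are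
members, if each member with two points is contained in another member or meets one of higher
rank. -/
lemma card_biUnion_le_of_rank {α β : Type*} [DecidableEq α] [DecidableEq β] (E : Finset α)
    (R : α → Finset β) (rank : α → ℕ) (hcard : ∀ e ∈ E, (R e).card ≤ 2)
    (h : ∀ e ∈ E, (R e).card = 2 → ∃ e' ∈ E, e' ≠ e ∧
      (R e ⊆ R e' ∨ (rank e < rank e' ∧ (R e ∩ R e').Nonempty))) :
    (E.biUnion R).card ≤ E.card := by
  classical
  rcases E.eq_empty_or_nonempty with rfl | ⟨e₀, -⟩
  · simp
  have : Nonempty α := ⟨e₀⟩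
  have hp : ∀ A ∈ E.image R, ∃ p ∈ E, R p = A := fun A hA => by simpa using hA
  choose! p hpE hpR using hp
  have hlo : ∀ A : Finset β, A.card = 2 → ∃ B ⊆ A, B.card = 1 := fun A hA =>
    Finset.exists_subset_card_eq (by omega)
  choose! lo hloA hlo1 using hlo
  -- Each member is charged with a set `S` of at most one point. If a pair occurs several times, its
  -- representative `p` takes the point `lo` and the other copies take the second point. A pair that
  -- occurs once takes the point that it need not share with its neighbour of higher rank.
  have hρ : ∀ e ∈ E, ∃ S : Finset β, S.card ≤ 1 ∧ ((R e).card ≤ 1 → R e ⊆ S) ∧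
      ((R e).card = 2 → (∃ e' ∈ E, e' ≠ e ∧ R e' = R e) →
        (e = p (R e) → lo (R e) ⊆ S) ∧ (e ≠ p (R e) → R e \ lo (R e) ⊆ S)) ∧
      ((R e).card = 2 → (¬ ∃ e' ∈ E, e' ≠ e ∧ R e' = R e) →
        ∃ e' ∈ E, rank e < rank e' ∧ R e ⊆ S ∪ R e') := by
    intro e he
    by_cases h1 : (R e).card ≤ 1
    · exact ⟨R e, h1, fun _ => subset_rfl, fun h2 => by omega, fun h2 => by omega⟩
    have h2 : (R e).card = 2 := by have := hcard e he; omega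
    by_cases ht : ∃ e' ∈ E, e' ≠ e ∧ R e' = R e
    · by_cases hep : e = p (R e)
      · exact ⟨lo (R e), (hlo1 _ h2).le, fun h => absurd h h1,
          fun _ _ => ⟨fun _ => subset_rfl, fun h => absurd hep h⟩, fun _ h => absurd ht h⟩
      · refine ⟨R e \ lo (R e), ?_, fun h => absurd h h1,
          fun _ _ => ⟨fun h => absurd h hep, fun _ => subset_rfl⟩, fun _ h => absurd ht h⟩
        rw [Finset.card_sdiff_of_subset (hloA _ h2), h2, hlo1 _ h2]
    · obtain ⟨e', he', hne, hsub | ⟨hr, b, hb⟩⟩ := h e he h2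
      · exact absurd ⟨e', he', hne, (Finset.eq_of_subset_of_card_le hsub
          (by have := hcard e' he'; omega)).symm⟩ ht
      · rw [Finset.mem_inter] at hb
        refine ⟨(R e).erase b, ?_, fun h => absurd h h1, fun _ h => absurd h ht,
          fun _ _ => ⟨e', he', hr, fun x hx => ?_⟩⟩
        · rw [Finset.card_erase_of_mem hb.1, h2]
        · by_cases hxb : x = b
          · rw [hxb]
            exact Finset.mem_union_right _ hb.2
          · exact Finset.mem_union_left _ (Finset.mem_erase.2 ⟨hxb, hx⟩)
  choose! ρ hρ1 hρs hρt hρr using hρ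
  -- Downward induction on the rank: the point left out by a pair is covered through its neighbour
  -- of higher rank.
  have hcover : ∀ (N : ℕ) (e : α), e ∈ E → E.sup rank < rank e + N → R e ⊆ E.biUnion ρ := by
    intro N
    induction N with
    | zero =>
      intro e he hN
      have := Finset.le_sup (f := rank) he
      omega
    | succ N ih =>
      intro e he hN
      have hsub : ∀ e ∈ E, ρ e ⊆ E.biUnion ρ := fun e he => Finset.subset_biUnion_of_mem ρ he
      by_cases h1 : (R e).card ≤ 1
      · exact (hρs e he h1).trans (hsub e he)
      have h2 : (R e).card = 2 := by have := hcard e he; omega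
      by_cases ht : ∃ e' ∈ E, e' ≠ e ∧ R e' = R e
      · have hmem := Finset.mem_image_of_mem R he
        have hP := hpE _ hmem
        have hPR := hpR _ hmem
        obtain ⟨e', he', hne, hR'⟩ := ht
        have hlo' : lo (R e) ⊆ E.biUnion ρ := by
          have h3 := (hρt (p (R e)) hP (by rw [hPR, h2]) (by
            by_cases hpe : p (R e) = e
            · exact ⟨e', he', by rwa [hpe], by rw [hpe, hR']⟩
            · exact ⟨e, he, Ne.symm hpe, hPR.symm⟩)).1 (by rw [hPR])
          rw [hPR] at h3
          exact h3.trans (hsub _ hP)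
        have hhi : R e \ lo (R e) ⊆ E.biUnion ρ := by
          by_cases hpe : e = p (R e)
          · have h3 := (hρt e' he' (by rw [hR', h2]) ⟨e, he, hne.symm, hR'.symm⟩).2
              (by rw [hR', ← hpe]; exact hne)
            rw [hR'] at h3
            exact h3.trans (hsub _ he')
          · exact ((hρt e he h2 ⟨e', he', hne, hR'⟩).2 hpe).trans (hsub _ he)
        rw [← Finset.union_sdiff_of_subset (hloA _ h2)]
        exact Finset.union_subset hlo' hhi
      · obtain ⟨e', he', hr, hs⟩ := hρr e he h2 ht
        exact hs.trans (Finset.union_subset (hsub e he) (ih e' he' (by omega)))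
  calc (E.biUnion R).card ≤ (E.biUnion ρ).card :=
        Finset.card_le_card (Finset.biUnion_subset.2 fun e he =>
          hcover (E.sup rank + 1) e he (by omega))
    _ ≤ E.card * 1 := Finset.card_biUnion_le_card_mul _ _ _ fun e he => hρ1 e he
    _ = E.card := mul_one _

namespace CCZCircuit
variable {C : CCZCircuit m n}

/-! ### Lightcones -/

lemma mem_rowsMet {c : Fin 3} {Q : Finset (Qubit m n)} {r : Fin m} :
    r ∈ rowsMet c Q ↔ ∃ j, (c, r, j) ∈ Q := by
  simp only [rowsMet, Finset.mem_image, Finset.mem_filter]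
  constructor
  · rintro ⟨⟨b, i, j⟩, ⟨hq, rfl⟩, rfl⟩
    exact ⟨j, hq⟩
  · rintro ⟨j, hj⟩
    exact ⟨_, ⟨hj, rfl⟩, rfl⟩

lemma mem_spread_supp {v : Fin C.depth} {g : CCZGate m n} {c : Fin 3} {x : Fin m × Fin n} :
    (c, x) ∈ C.spread v (supp g) ↔ x = g c ∨ ∃ h ∈ C.step v, h c = x ∧ ∃ b, h b = g b := by
  simp only [spread, Finset.mem_filter, Finset.mem_univ, true_and]
  constructor
  · rintro ⟨s, hs, q, hq, hi, hj⟩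
    rcases mem_gateSupports.1 hs with ⟨h, hh, rfl⟩ | ⟨q', -, rfl⟩
    · rw [mem_supp] at hq hj
      exact Or.inr ⟨h, hh, (mem_supp_mk.1 hi).symm, q.1, hj.symm.trans hq⟩
    · rw [Finset.mem_singleton] at hi hj
      rw [hj, ← hi] at hq
      exact Or.inl (mem_supp_mk.1 hq)
  · rintro (rfl | ⟨h, hh, rfl, b, hb⟩)
    · obtain ⟨s, hs, hq⟩ := exists_mem_gateSupports v (c, g c)
      exact ⟨s, hs, _, mem_supp_mk.2 rfl, hq, hq⟩
    · exact ⟨supp h, supp_mem_gateSupports hh, (b, h b), mem_supp_mk.2 hb, mem_supp_mk.2 rfl,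
        mem_supp_mk.2 rfl⟩

lemma mem_rowsMet_modifiedLightcone {t : Fin C.depth} {g : CCZGate m n} {c : Fin 3} {r : Fin m} :
    r ∈ rowsMet c (C.modifiedLightcone t g) ↔
      ∃ v, t < v ∧ (r = (g c).1 ∨ ∃ h ∈ C.step v, (h c).1 = r ∧ ∃ b, h b = g b) := by
  simp only [mem_rowsMet, modifiedLightcone, Finset.mem_biUnion, Finset.mem_filter,
    Finset.mem_univ, true_and, mem_spread_supp]
  constructor
  · rintro ⟨j, v, hv, h | ⟨h, hh, hc, hb⟩⟩
    · exact ⟨v, hv, Or.inl (congrArg Prod.fst h)⟩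
    · exact ⟨v, hv, Or.inr ⟨h, hh, congrArg Prod.fst hc, hb⟩⟩
  · rintro ⟨v, hv, rfl | ⟨h, hh, rfl, hb⟩⟩
    · exact ⟨(g c).2, v, hv, Or.inl rfl⟩
    · exact ⟨(h c).2, v, hv, Or.inr ⟨h, hh, rfl, hb⟩⟩

/-- The rows of block `c` met by a gate of timestep `t` and the later gates that share a qubit
with it. -/
def coneRows (C : CCZCircuit m n) (t : Fin C.depth) (g : CCZGate m n) (c : Fin 3) :
    Finset (Fin m) :=
  Finset.univ.filter fun r =>
    r = (g c).1 ∨ ∃ v, t < v ∧ ∃ h ∈ C.step v, (h c).1 = r ∧ ∃ b, h b = g b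

lemma mem_coneRows {t : Fin C.depth} {g : CCZGate m n} {c : Fin 3} {r : Fin m} :
    r ∈ C.coneRows t g c ↔
      r = (g c).1 ∨ ∃ v, t < v ∧ ∃ h ∈ C.step v, (h c).1 = r ∧ ∃ b, h b = g b := by
  simp [coneRows]

/-- Any later timestep puts the row of `g` itself into the modified lightcone. In the last timestep
that lightcone is empty, but then `coneRows` is a single row. -/
lemma card_coneRows_le {t : Fin C.depth} {g : CCZGate m n} {c : Fin 3}
    (h : (rowsMet c (C.modifiedLightcone t g)).card ≤ 2) : (C.coneRows t g c).card ≤ 2 := by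
  by_cases hv : ∃ v, t < v
  · obtain ⟨v, hv⟩ := hv
    refine (Finset.card_le_card fun r hr => ?_).trans h
    rw [mem_rowsMet_modifiedLightcone]
    rcases mem_coneRows.1 hr with h1 | ⟨v', hv', h1⟩
    · exact ⟨v, hv, Or.inl h1⟩
    · exact ⟨v', hv', Or.inr h1⟩
  · refine (Finset.card_le_card (t := {(g c).1}) fun r hr => ?_).trans (by simp)
    rcases mem_coneRows.1 hr with h1 | ⟨v', hv', h1⟩
    · simp [h1]
    · exact absurd ⟨v', hv'⟩ hv

/-- The rows of block `c` met by the gates from timestep `k` on that act on the qubit `q`. -/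
def gateRows (C : CCZCircuit m n) (k : ℕ) (q : Qubit m n) (c : Fin 3) : Finset (Fin m) :=
  Finset.univ.filter fun r =>
    ∃ v : Fin C.depth, k ≤ v.val ∧ ∃ h ∈ C.step v, q ∈ supp h ∧ (h c).1 = r

lemma mem_gateRows {k : ℕ} {q : Qubit m n} {c : Fin 3} {r : Fin m} :
    r ∈ C.gateRows k q c ↔
      ∃ v : Fin C.depth, k ≤ v.val ∧ ∃ h ∈ C.step v, q ∈ supp h ∧ (h c).1 = r := by
  simp [gateRows]

/-- The first gate on `q` from timestep `k` on shares `q` with all the others, so its cone contains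
all these rows. -/
lemma card_gateRows_le {k : ℕ} {c : Fin 3}
    (H : ∀ v : Fin C.depth, k ≤ v.val → ∀ h ∈ C.step v,
      (rowsMet c (C.modifiedLightcone v h)).card ≤ 2) (q : Qubit m n) :
    (C.gateRows k q c).card ≤ 2 := by
  by_cases hne : ∃ v : Fin C.depth, k ≤ v.val ∧ ∃ h ∈ C.step v, q ∈ supp h
  · obtain ⟨v, ⟨hv, h, hh, hq⟩, hmin⟩ := WellFounded.has_min (wellFounded_lt (α := Fin C.depth))
      {v | k ≤ v.val ∧ ∃ h ∈ C.step v, q ∈ supp h} hne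
    refine (Finset.card_le_card fun r hr => ?_).trans (card_coneRows_le (H v hv h hh))
    obtain ⟨v', hv', h', hh', hq', hr'⟩ := mem_gateRows.1 hr
    rw [mem_coneRows]
    rcases (not_lt.1 (hmin v' ⟨hv', h', hh', hq'⟩)).eq_or_lt with rfl | hlt
    · rw [eq_of_mem_supp hh hh' hq hq']
      exact Or.inl hr'.symm
    · rw [mem_supp] at hq hq'
      exact Or.inr ⟨v', hlt, h', hh', hr', q.1, hq'.symm.trans hq⟩
  · rw [Finset.card_eq_zero.2]
    · omega
    · refine Finset.eq_empty_of_forall_notMem fun r hr => hne ?_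
      obtain ⟨v', hv', h', hh', hq', hr'⟩ := mem_gateRows.1 hr
      exact ⟨v', hv', h', hh', hq'⟩

lemma card_supp (g : CCZGate m n) : (supp g).card = 3 := by
  rw [supp, Finset.card_image_of_injective, Finset.card_univ, Fintype.card_fin]
  intro b b' h
  exact congrArg Prod.fst h

/-! ### Rows touched by an error event -/

open Classical in
/-- The rows of block `c` that an error event touches: those of the failing gate, and those of the
later gates that act on a flipped qubit. For an identity gate the earlier gates are included. -/
def eventRows (f : C.ErrorPattern) (c : Fin 3) (e : Fin C.depth × Finset (Qubit m n)) :
    Finset (Fin m) :=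
  Finset.univ.filter fun r => (∃ j, (c, r, j) ∈ e.2) ∨
    ∃ q ∈ e.2, xBit (f e.1 q) = 1 ∧
      ∃ v, ∃ h ∈ C.step v, q ∈ supp h ∧ (h c).1 = r ∧ (e.1 < v ∨ e.2 = {q})

lemma mem_eventRows {f : C.ErrorPattern} {c : Fin 3} {e : Fin C.depth × Finset (Qubit m n)}
    {r : Fin m} : r ∈ eventRows f c e ↔ (∃ j, (c, r, j) ∈ e.2) ∨
    ∃ q ∈ e.2, xBit (f e.1 q) = 1 ∧
      ∃ v, ∃ h ∈ C.step v, q ∈ supp h ∧ (h c).1 = r ∧ (e.1 < v ∨ e.2 = {q}) := by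
  simp only [eventRows, Finset.mem_filter, Finset.mem_univ, true_and]

lemma supp_ne_singleton (g : CCZGate m n) (q : Qubit m n) : supp g ≠ {q} := fun h => by
  have := card_supp g
  rw [h, Finset.card_singleton] at this
  omega

lemma eventRows_supp_subset {f : C.ErrorPattern} {c : Fin 3} {t : Fin C.depth}
    {g : CCZGate m n} : eventRows f c (t, supp g) ⊆ C.coneRows t g c := by
  intro r hr
  rw [mem_coneRows]
  rcases mem_eventRows.1 hr with ⟨j, hj⟩ | ⟨q, hq, -, v, h, hh, hqh, hr, hv | hs⟩
  · rw [← mem_supp_mk.1 hj]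
    exact Or.inl rfl
  · rw [mem_supp] at hq hqh
    exact Or.inr ⟨v, hv, h, hh, hr, q.1, hqh.symm.trans hq⟩
  · exact absurd hs (supp_ne_singleton g q)

lemma eventRows_singleton_subset {f : C.ErrorPattern} {c : Fin 3} {t : Fin C.depth}
    {q : Qubit m n} (hq : q.1 ≠ c) : eventRows f c (t, {q}) ⊆ C.gateRows 0 q c := by
  intro r hr
  rw [mem_gateRows]
  rcases mem_eventRows.1 hr with ⟨j, hj⟩ | ⟨q', hq', -, v, h, hh, hqh, hr, -⟩
  · rw [Finset.mem_singleton] at hj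
    exact absurd (by rw [← hj]) hq
  · rw [Finset.mem_singleton] at hq'
    exact ⟨v, Nat.zero_le _, h, hh, hq' ▸ hqh, hr⟩

lemma eventRows_singleton_subset_of_eq {f : C.ErrorPattern} {c : Fin 3} {t : Fin C.depth}
    {q : Qubit m n} (hq : q.1 = c) : eventRows f c (t, {q}) ⊆ {q.2.1} := by
  intro r hr
  rw [Finset.mem_singleton]
  rcases mem_eventRows.1 hr with ⟨j, hj⟩ | ⟨q', hq', -, v, h, hh, hqh, hr, -⟩
  · rw [Finset.mem_singleton] at hj
    rw [← hj]
  · rw [Finset.mem_singleton] at hq'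
    rw [hq', mem_supp, hq] at hqh
    rw [← hr, hqh]

lemma card_eventRows_le (hC : C.TwoRowLightcones) (f : C.ErrorPattern) (c : Fin 3)
    {t : Fin C.depth} {s : Finset (Qubit m n)} (hs : s ∈ C.gateSupports t) :
    (eventRows f c (t, s)).card ≤ 2 := by
  rcases mem_gateSupports.1 hs with ⟨g, hg, rfl⟩ | ⟨q, -, rfl⟩
  · exact (Finset.card_le_card eventRows_supp_subset).trans (card_coneRows_le (hC t g hg c))
  · by_cases hq : q.1 = c
    · exact (Finset.card_le_card (eventRows_singleton_subset_of_eq hq)).trans (by simp)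
    · exact (Finset.card_le_card (eventRows_singleton_subset hq)).trans
        (card_gateRows_le (fun v _ h hh => hC v h hh c) q)

/-- An event that touches two rows of block `c` flips a qubit all of whose gates act on these
rows. -/
lemma exists_flip_of_card_eq_two (hC : C.TwoRowLightcones) {f : C.ErrorPattern} {c : Fin 3}
    {t : Fin C.depth} {s : Finset (Qubit m n)} (hs : s ∈ C.gateSupports t)
    (h2 : (eventRows f c (t, s)).card = 2) :
    ∃ q ∈ s, xBit (f t q) = 1 ∧ eventRows f c (t, s) = C.gateRows 0 q c ∧
      (s = {q} ∨ ∃ g ∈ C.step t, s = supp g ∧ ∃ v, t < v ∧ ∃ h ∈ C.step v, q ∈ supp h ∧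
        eventRows f c (t, s) = {(g c).1, (h c).1}) := by
  have hle : ∀ q, (C.gateRows 0 q c).card ≤ 2 :=
    card_gateRows_le (fun v _ h hh => hC v h hh c)
  rcases mem_gateSupports.1 hs with ⟨g, hg, rfl⟩ | ⟨q, -, rfl⟩
  · have hg1 : (g c).1 ∈ eventRows f c (t, supp g) :=
      mem_eventRows.2 (Or.inl ⟨(g c).2, mem_supp_mk.2 rfl⟩)
    obtain ⟨r, hr, hne⟩ := Finset.exists_mem_ne (by omega) (g c).1 (s := eventRows f c (t, supp g))
    rcases mem_eventRows.1 hr with ⟨j, hj⟩ | ⟨q, hq, hx, v, h, hh, hqh, hr', hv | hs'⟩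
    · exact absurd (congrArg Prod.fst (mem_supp_mk.1 hj)) hne
    · have heq : eventRows f c (t, supp g) = {(g c).1, (h c).1} := by
        refine (Finset.eq_of_subset_of_card_le ?_ ?_).symm
        · rw [hr']
          exact Finset.insert_subset hg1 (Finset.singleton_subset_iff.2 hr)
        · rw [h2, hr', Finset.card_pair hne.symm]
      refine ⟨q, hq, hx, Finset.eq_of_subset_of_card_le ?_ (by rw [h2]; exact hle q),
        Or.inr ⟨g, hg, rfl, v, hv, h, hh, hqh, heq⟩⟩
      rw [heq]
      refine Finset.insert_subset ?_ (Finset.singleton_subset_iff.2 ?_)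
      · exact mem_gateRows.2 ⟨t, Nat.zero_le _, g, hg, hq, rfl⟩
      · exact mem_gateRows.2 ⟨v, Nat.zero_le _, h, hh, hqh, rfl⟩
    · exact absurd hs' (supp_ne_singleton g q)
  · have hqc : q.1 ≠ c := fun h => by
      have := Finset.card_le_card (eventRows_singleton_subset_of_eq (f := f) (t := t) h)
      rw [Finset.card_singleton] at this
      omega
    have hx : xBit (f t q) = 1 := by
      obtain ⟨r, hr⟩ := Finset.card_pos.1 (by omega : 0 < (eventRows f c (t, {q})).card)
      rcases mem_eventRows.1 hr with ⟨j, hj⟩ | ⟨q', hq', hx, -⟩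
      · rw [Finset.mem_singleton] at hj
        exact absurd (by rw [← hj]) hqc
      · rwa [Finset.mem_singleton.1 hq'] at hx
    exact ⟨q, by simp, hx, Finset.eq_of_subset_of_card_le (eventRows_singleton_subset hqc)
      (by rw [h2]; exact hle q), Or.inl rfl⟩

/-! ### Counting the rows touched by a pair of error patterns -/

/-- The failing gates of a pair of error patterns. -/
def pairEvents (F : Bool → C.ErrorPattern) :
    Finset (Σ _ : Bool, Fin C.depth × Finset (Qubit m n)) :=
  Finset.univ.sigma fun i => events (F i)

lemma mem_pairEvents {F : Bool → C.ErrorPattern}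
    {e : Σ _ : Bool, Fin C.depth × Finset (Qubit m n)} :
    e ∈ pairEvents F ↔ e.2 ∈ events (F e.1) := by
  simp [pairEvents]

lemma card_pairEvents (F : Bool → C.ErrorPattern) :
    (pairEvents F).card = (events (F false)).card + (events (F true)).card := by
  rw [pairEvents, Finset.card_sigma, Fintype.sum_bool, add_comm]

lemma frame_add_frame_apply (F : Bool → C.ErrorPattern) (q : Qubit m n) :
    (frame (F false) + frame (F true)) q = ∑ p : Bool × Fin C.depth, xBit (F p.1 p.2 q) := by
  rw [Fintype.sum_prod_type, Fintype.sum_bool, add_comm]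
  simp [frame, xPart]

/-- Equal frames mean that the two patterns together flip each qubit an even number of times. -/
lemma exists_ne_flip {F : Bool → C.ErrorPattern} (hF : frame (F false) = frame (F true))
    {q : Qubit m n} {p : Bool × Fin C.depth} (hp : xBit (F p.1 p.2 q) = 1) :
    ∃ p' : Bool × Fin C.depth, p' ≠ p ∧ xBit (F p'.1 p'.2 q) = 1 := by
  by_contra! hc
  have h1 := frame_add_frame_apply F q
  rw [hF, Config.add_self, Finset.sum_eq_single p, hp] at h1
  · exact absurd h1 (by simp)
  · intro p' _ hne
    by_contra h0
    exact hc p' hne (fin_two_eq_one h0)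
  · simp

lemma ne_zero_of_xBit {v : Fin 4} (h : xBit v = 1) : v ≠ 0 := by
  rintro rfl
  exact absurd h (by decide)

/-- An event with two touched rows flips a qubit `q` whose gates meet exactly these rows, and
another event flips `q` as well. Comparing the two events gives the containment or overlap that
`card_biUnion_le_of_rank` asks for. -/
lemma card_touchedRows_le (hC : C.TwoRowLightcones) {F : Bool → C.ErrorPattern}
    (hF : frame (F false) = frame (F true)) (c : Fin 3) :
    ((pairEvents F).biUnion fun e => eventRows (F e.1) c e.2).card ≤ (pairEvents F).card := by
  -- CCZ gates are ranked by timestep; the `+ 1` places identity gates below all of them.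
  refine card_biUnion_le_of_rank _ _ (fun e => if e.2.2.card = 1 then 0 else e.2.1.val + 1)
    (fun e he => card_eventRows_le hC _ c (mem_events.1 (mem_pairEvents.1 he)).1) ?_
  rintro ⟨i, t, s⟩ he h2
  have hs := (mem_events.1 (mem_pairEvents.1 he)).1
  obtain ⟨q, hq, hx, hrows, hkind⟩ := exists_flip_of_card_eq_two hC hs h2
  obtain ⟨⟨i', t'⟩, hne, hx'⟩ := exists_ne_flip hF (p := (i, t)) hx
  obtain ⟨s', hq', he'⟩ := exists_event (ne_zero_of_xBit hx')
  refine ⟨⟨i', t', s'⟩, mem_pairEvents.2 he', ?_, ?_⟩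
  · rintro h
    cases h
    exact hne rfl
  dsimp only at *
  rcases mem_gateSupports.1 (mem_events.1 he').1 with ⟨g', hg', rfl⟩ | ⟨q', -, rfl⟩
  · have hg1 : (g' c).1 ∈ eventRows (F i') c (t', supp g') :=
      mem_eventRows.2 (Or.inl ⟨(g' c).2, mem_supp_mk.2 rfl⟩)
    have hg2 : (g' c).1 ∈ eventRows (F i) c (t, s) := by
      rw [hrows, mem_gateRows]
      exact ⟨t', Nat.zero_le _, g', hg', hq', rfl⟩
    have hmeet := (⟨_, Finset.mem_inter.2 ⟨hg2, hg1⟩⟩ :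
      (eventRows (F i) c (t, s) ∩ eventRows (F i') c (t', supp g')).Nonempty)
    rcases hkind with rfl | ⟨g, hg, rfl, v, hv, h, hh, hqh, heq⟩
    · exact Or.inr ⟨by simp [card_supp], hmeet⟩
    · rcases lt_or_ge t t' with hlt | hge
      · exact Or.inr ⟨by simpa [card_supp] using hlt, hmeet⟩
      -- The other event is not later than this one, so `g` and `h` act on the flipped `q` at or
      -- after it and their rows are touched by it too.
      · left
        rw [heq]
        refine Finset.insert_subset ?_ (Finset.singleton_subset_iff.2 ?_)
        · rcases hge.eq_or_lt with rfl | hlt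
          · rwa [eq_of_mem_supp hg hg' hq hq']
          · exact mem_eventRows.2 (Or.inr ⟨q, hq', hx', t, g, hg, hq, rfl, Or.inl hlt⟩)
        · exact mem_eventRows.2
            (Or.inr ⟨q, hq', hx', v, h, hh, hqh, rfl, Or.inl (hge.trans_lt hv)⟩)
  -- An identity gate that flips `q` touches the rows of all gates on `q`, earlier ones included.
  · left
    rw [Finset.mem_singleton] at hq'
    subst hq'
    rw [hrows]
    intro r hr
    obtain ⟨v, -, h, hh, hqh, hr⟩ := mem_gateRows.1 hr
    exact mem_eventRows.2 (Or.inr ⟨q, by simp, hx', v, h, hh, hqh, hr, Or.inr rfl⟩)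

/-- The propagated errors do not depend on an untouched row. -/
lemma framePhase_add_rowFlip {f : C.ErrorPattern} {c : Fin 3} {r : Fin m}
    (hr : ∀ e ∈ events f, r ∉ eventRows f c e) (y : Config m n) :
    framePhase f (y + rowFlip c r) = framePhase f y := by
  have h0 : ∀ t j, f t (c, r, j) = 0 := by
    intro t j
    by_contra h
    obtain ⟨s, hq, hs⟩ := exists_event h
    exact hr _ hs (mem_eventRows.2 (Or.inl ⟨j, hq⟩))
  have h1 : ∀ v, ∀ h ∈ C.step v, (h c).1 = r → ∀ b, frameBefore f v (b, h b) = 0 := by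
    intro v h hh hrow b
    rw [frameBefore, Finset.sum_apply]
    refine Finset.sum_eq_zero fun s _ => ?_
    split_ifs with hs
    · by_contra hx
      have hx' : xBit (f s (b, h b)) = 1 := fin_two_eq_one hx
      obtain ⟨S, hq, hS⟩ := exists_event (ne_zero_of_xBit hx')
      exact hr _ hS (mem_eventRows.2
        (Or.inr ⟨_, hq, hx', v, h, hh, mem_supp_mk.2 rfl, hrow, Or.inl hs⟩))
    · rfl
  have hflip : ∀ q : Qubit m n, ¬ (q.1 = c ∧ q.2.1 = r) → rowFlip c r q = 0 := by
    intro q hq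
    simp [rowsFlip, hq]
  refine Finset.prod_congr rfl fun t _ => ?_
  congr 1
  · refine Finset.prod_congr rfl fun q _ => ?_
    by_cases hq : q.1 = c ∧ q.2.1 = r
    · obtain ⟨b, i, j⟩ := q
      obtain ⟨rfl, rfl⟩ := hq
      rw [h0]
      simp [pauliPhase, zBit]
    · simp only [Pi.add_apply, hflip q hq, add_zero]
  · simp only [stepPhase, ← Finset.prod_mul_distrib]
    refine Finset.prod_congr rfl fun g hg => ?_
    -- A gate on row `r` sees no earlier flip, so its two phases cancel; any other gate does not see
    -- the flip of row `r`.
    by_cases hrow : (g c).1 = r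
    · have h2 : ∀ z : Config m n, gatePhase g (z + frameBefore f t) = gatePhase g z :=
        fun z => gatePhase_congr fun b => by rw [Pi.add_apply, h1 t g hg hrow b, add_zero]
      rw [h2, h2, gatePhase_mul_self, gatePhase_mul_self]
    · have h2 : ∀ b, rowFlip c r (b, g b) = 0 := fun b => hflip _ (by
        rintro ⟨h3, h4⟩
        dsimp only at h3 h4
        exact hrow (h3 ▸ h4))
      congr 1 <;> refine gatePhase_congr fun b => ?_
      · simp only [Pi.add_apply, h2, add_zero]
      · simp only [Pi.add_apply, h2, add_zero]

/-! ### Two-row lightcones suffice -/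

/-- The operator `P E_f† P_α E_f' P`, up to the amplitudes. -/
def sandwich (f f' : C.ErrorPattern) (T : Op m n) : Op m n :=
  codeProj m n * (C.propagated f)ᴴ * T * C.propagated f' * codeProj m n

/-- The projectors commute with the `Z` operator, and each propagated error contributes the sign of
its frame. -/
lemma sandwich_mul_zOp (f f' : C.ErrorPattern) (α : Gen m n → Fin 2) {Q : Finset (Qubit m n)}
    (hQ : ∀ k : Gen m n, Commute (zOp Q) (stabGen k)) :
    sandwich f f' (syndromeProj α) * zOp Q =
      zPhase Q (frame f + frame f') • (zOp Q * sandwich f f' (syndromeProj α)) := by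
  have h1 := mono_mul_diagonal_hom (frame f') (framePhase f') (zPhase Q) (zPhase_add Q)
    (zPhase_mul_self Q)
  have h2 := mono_mul_diagonal_hom (frame f) (fun y => star (framePhase f (y + frame f)))
    (zPhase Q) (zPhase_add Q) (zPhase_mul_self Q)
  rw [← propagated_eq_mono] at h1
  rw [← mono_conjTranspose, ← propagated_eq_mono] at h2
  change _ * zOp Q = _ • (zOp Q * _) at h1 h2
  have hP : codeProj m n * zOp Q = zOp Q * codeProj m n := (commute_syndromeProj hQ _).eq.symm
  have hα := (commute_syndromeProj hQ α).eq
  rw [sandwich, mul_assoc, hP, ← mul_assoc, mul_assoc _ (C.propagated f'), h1, mul_smul_comm,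
    ← mul_assoc, mul_assoc _ (syndromeProj α), ← hα, ← mul_assoc, mul_assoc (codeProj m n), h2,
    mul_smul_comm, ← mul_assoc, hP, zPhase_add]
  simp only [smul_mul_assoc, smul_smul, mul_assoc, mul_comm]

lemma sandwich_commute_xOp {f f' : C.ErrorPattern} (α : Gen m n → Fin 2) {c : Fin 3} {r : Fin m}
    (hf : ∀ e ∈ events f, r ∉ eventRows f c e) (hf' : ∀ e ∈ events f', r ∉ eventRows f' c e) :
    Commute (xOp (rowFlip c r)) (sandwich f f' (syndromeProj α)) := by
  have key : ∀ (A : Config m n) (φ : Config m n → ℂ), (∀ y, φ (y + rowFlip c r) = φ y) →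
      Commute (xOp (rowFlip c r)) (mono A φ) := by
    intro A φ h
    rw [xOp, Commute, SemiconjBy, mono_mul_mono, mono_mul_mono, add_comm]
    simp only [h, one_mul, mul_one]
  have h1 : Commute (xOp (rowFlip c r)) (C.propagated f') := by
    rw [propagated_eq_mono]
    exact key _ _ (framePhase_add_rowFlip hf')
  have h2 : Commute (xOp (rowFlip c r)) (C.propagated f)ᴴ := by
    rw [propagated_eq_mono, mono_conjTranspose]
    exact key _ _ fun y => by rw [add_right_comm, framePhase_add_rowFlip hf]
  have hα : ∀ α : Gen m n → Fin 2, Commute (xOp (rowFlip c r)) (syndromeProj α) :=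
    fun α => commute_syndromeProj (xOp_rowsFlip_commute c _) α
  exact ((((hα _).mul_right h2).mul_right (hα α)).mul_right h1).mul_right (hα _)

lemma stabGen_mul_sandwich (f f' : C.ErrorPattern) (T : Op m n) (k : Gen m n) :
    stabGen k * sandwich f f' T = sandwich f f' T := by
  simp only [sandwich, ← mul_assoc, stabGen_mul_codeProj]

lemma sandwich_mul_stabGen (f f' : C.ErrorPattern) (T : Op m n) (k : Gen m n) :
    sandwich f f' T * stabGen k = sandwich f f' T := by
  rw [sandwich, mul_assoc, codeProj_mul_stabGen]

/-- Fewer than `n` errors do not flip all the qubits of a row. -/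
lemma not_rowConst_frame {F : Bool → C.ErrorPattern} (hcard : (pairEvents F).card < n)
    (hF : frame (F false) ≠ frame (F true)) :
    ¬ RowConst (frame (F false) + frame (F true)) := by
  intro hconst
  obtain ⟨⟨c, i, j⟩, hq⟩ : ∃ q, (frame (F false) + frame (F true)) q ≠ 0 := by
    by_contra! hc
    refine hF ?_
    have h1 : frame (F false) + frame (F true) = 0 := funext hc
    rw [← Config.add_add_cancel (frame (F false)) (frame (F true)), h1, zero_add]
  have hall : ∀ j' : Fin n, ∃ e ∈ pairEvents F, (c, i, j') ∈ e.2.2 := by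
    intro j'
    rw [hconst c i j j', frame_add_frame_apply] at hq
    obtain ⟨⟨b, t⟩, -, hx⟩ := Finset.exists_ne_zero_of_sum_ne_zero hq
    obtain ⟨s, hs, he⟩ := exists_event (ne_zero_of_xBit (fin_two_eq_one hx))
    exact ⟨⟨b, t, s⟩, mem_pairEvents.2 he, hs⟩
  choose e he hmem using hall
  have hinj : Function.Injective e := by
    intro j₁ j₂ h
    have h2 := hmem j₂
    rw [← h] at h2
    have h3 := eq_of_fst_eq (mem_events.1 (mem_pairEvents.1 (he j₁))).1 (hmem j₁) h2 rfl
    simpa using h3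
  have := Finset.card_le_card_of_injOn e (s := Finset.univ) (fun j' _ => he j') hinj.injOn
  rw [Finset.card_univ, Fintype.card_fin] at this
  omega

lemma sandwich_eq_smul (hmn : m ≤ n) (hC : C.TwoRowLightcones) {f f' : C.ErrorPattern}
    (hcard : (events f).card + (events f').card < m) (α : Gen m n → Fin 2) :
    sandwich f f' (syndromeProj α) =
      (sandwich f f' (syndromeProj α) 0 0 / codeProj m n 0 0) • codeProj m n := by
  obtain ⟨F, rfl, rfl⟩ : ∃ F : Bool → C.ErrorPattern, F false = f ∧ F true = f' :=
    ⟨fun i => cond i f' f, rfl, rfl⟩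
  rw [← card_pairEvents] at hcard
  by_cases hF : frame (F false) = frame (F true)
  · have hfree : ∀ c : Fin 3, ∃ r : Fin m, ∀ e ∈ pairEvents F, r ∉ eventRows (F e.1) c e.2 := by
      intro c
      have h1 := card_touchedRows_le hC hF c
      obtain ⟨r, hr⟩ := Finset.exists_mem_notMem_of_card_lt_card
        (s := (pairEvents F).biUnion fun e => eventRows (F e.1) c e.2) (t := Finset.univ)
        (by rw [Finset.card_univ, Fintype.card_fin]; omega)
      exact ⟨r, fun e he h => hr.2 (Finset.mem_biUnion.2 ⟨e, he, h⟩)⟩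
    choose r hr using hfree
    have j : Fin n := ⟨0, by omega⟩
    refine IsScalarOnCode.eq_smul (i := r) (j := j)
      ⟨stabGen_mul_sandwich _ _ _, sandwich_mul_stabGen _ _ _, fun c => ?_, fun c => ?_⟩
    · exact sandwich_commute_xOp α (fun e he => hr c ⟨false, e⟩ (mem_pairEvents.2 he))
        (fun e he => hr c ⟨true, e⟩ (mem_pairEvents.2 he))
    · have h1 := sandwich_mul_zOp (F false) (F true) α (zOp_col_commute c j)
      rw [hF, Config.add_self, zPhase_zero, one_smul] at h1
      exact h1.symm
  · obtain ⟨k, hk, hk'⟩ := exists_genZ_of_not_rowConst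
      (not_rowConst_frame (hcard.trans_le hmn) hF)
    have hz : zOp (genZ k) = stabGen k := by rw [stabGen_eq_mono, hk, zOp]
    -- The sandwich absorbs the generator on both sides, yet moving it across costs a sign, so the
    -- sandwich equals its negative.
    have h1 := sandwich_mul_zOp (F false) (F true) α (Q := genZ k)
      (by rw [hz]; exact stabGen_commute k)
    rw [hz, hk', sandwich_mul_stabGen, stabGen_mul_sandwich] at h1
    have h0 : sandwich (F false) (F true) (syndromeProj α) = 0 := by
      ext x y
      have := congrFun (congrFun h1 x) y
      rw [Matrix.smul_apply, smul_eq_mul] at this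
      rw [Matrix.zero_apply]
      linear_combination (1 / 2 : ℂ) * this
    rw [h0]
    simp

lemma sandwich_conjTranspose (f f' : C.ErrorPattern) (α : Gen m n → Fin 2) :
    (sandwich f f' (syndromeProj α))ᴴ = sandwich f' f (syndromeProj α) := by
  simp only [sandwich, Matrix.conjTranspose_mul, codeProj_conjTranspose,
    syndromeProj_conjTranspose, Matrix.conjTranspose_conjTranspose, mul_assoc]

theorem hasEffectiveDistanceSPR_of_twoRowLightcones (hmn : m ≤ n) (hC : C.TwoRowLightcones) :
    HasEffectiveDistanceSPR C.kraus m := by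
  refine ⟨fun α ε => Matrix.of fun f f' => ((C.amplitude f ε * C.amplitude f' ε : ℝ) : ℂ) *
    (sandwich f f' (syndromeProj α) 0 0 / codeProj m n 0 0), fun α ε => ?_, ?_⟩
  · ext f f'
    have h1 : star (sandwich f' f (syndromeProj α) 0 0) = sandwich f f' (syndromeProj α) 0 0 := by
      rw [← Matrix.conjTranspose_apply, sandwich_conjTranspose]
    have h2 : star (codeProj m n 0 0) = codeProj m n 0 0 := by
      rw [← Matrix.conjTranspose_apply, codeProj_conjTranspose]
    change star (((C.amplitude f' ε * C.amplitude f ε : ℝ) : ℂ) *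
        (sandwich f' f (syndromeProj α) 0 0 / codeProj m n 0 0)) =
      ((C.amplitude f ε * C.amplitude f' ε : ℝ) : ℂ) *
        (sandwich f f' (syndromeProj α) 0 0 / codeProj m n 0 0)
    rw [star_mul', star_div₀, h1, h2, mul_comm (C.amplitude f' ε)]
    simp
  · intro α f f' x y
    set D : ℂ := (sandwich f f' (syndromeProj α) -
      (sandwich f f' (syndromeProj α) 0 0 / codeProj m n 0 0) • codeProj m n) x y with hD
    have h1 : ∀ ε, (codeProj m n * (C.kraus ε f)ᴴ * syndromeProj α * C.kraus ε f' * codeProj m n -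
        (Matrix.of fun f f' => ((C.amplitude f ε * C.amplitude f' ε : ℝ) : ℂ) *
          (sandwich f f' (syndromeProj α) 0 0 / codeProj m n 0 0)) f f' • codeProj m n) x y =
        ((C.amplitude f ε * C.amplitude f' ε : ℝ) : ℂ) * D := by
      intro ε
      rw [kraus_sandwich, Matrix.of_apply, hD, mul_smul, ← smul_sub, Matrix.smul_apply,
        smul_eq_mul, sandwich]
    simp only [h1]
    rcases lt_or_ge ((events f).card + (events f').card) m with hlt | hge
    · have : D = 0 := by
        rw [hD, ← sandwich_eq_smul hmn hC hlt, sub_self, Matrix.zero_apply]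
      simp only [this, mul_zero]
      exact isBigO_zero _ _
    -- With at least `m` failures the amplitudes alone are `O(ε ^ m)`.
    · have h2 := ((amplitude_isTheta f).mul (amplitude_isTheta f')).isBigO
      simp only [← pow_add] at h2
      have h3 : (fun ε : ℝ => ε ^ ((events f).card + (events f').card)) =O[𝓝[>] (0 : ℝ)]
          fun ε => ε ^ m := by
        refine IsBigO.of_bound 1 ?_
        filter_upwards [Ioo_mem_nhdsGT (zero_lt_one (α := ℝ))] with ε hε
        rw [one_mul, norm_pow, norm_pow]
        exact pow_le_pow_of_le_one (norm_nonneg _)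
          (by rw [Real.norm_of_nonneg hε.1.le]; exact hε.2.le) hge
      have h4 := (IsBigO.of_norm_left (f' := fun ε : ℝ =>
        ((C.amplitude f ε * C.amplitude f' ε : ℝ) : ℂ)) (by
          simpa using (h2.trans h3).norm_left))
      simpa [mul_comm] using h4.const_mul_left D

end CCZCircuit

/-! ### Stabilizers as combinations of syndrome projectors -/

/-- The product of a set of stabilizer generators. -/
def genProd (K : Finset (Gen m n)) : Op m n :=
  ((Finset.univ : Finset (Gen m n)).toList.map fun k => if k ∈ K then stabGen k else 1).prod

/-- The sum and the difference of the two factors `(I ± s_k) / 2` are `I` and `s_k`. This transfers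
correctability from the `P_α` to products of stabilizers. -/
lemma genProd_mem (V : Submodule ℂ (Op m n)) (hV : ∀ α, syndromeProj α ∈ V)
    (K : Finset (Gen m n)) : genProd K ∈ V := by
  -- `T` collects the generators already resolved; without duplicates the sign of `k` can be changed
  -- and leave the other factors alone.
  have key : ∀ l : List (Gen m n), l.Nodup → ∀ T : Op m n,
      (∀ α, T * (l.map (genProj α)).prod ∈ V) →
      T * (l.map fun k => if k ∈ K then stabGen k else 1).prod ∈ V := by
    intro l
    induction l with
    | nil => intro _ T hT; exact hT 0
    | cons k l ih =>
      intro hl T hT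
      rw [List.nodup_cons] at hl
      have hup : ∀ (α : Gen m n → Fin 2) (a : Fin 2),
          T * ((2⁻¹ : ℂ) • (1 + ((-1 : ℂ) ^ a.val) • stabGen k)) * (l.map (genProj α)).prod ∈ V := by
        intro α a
        have h1 := hT (Function.update α k a)
        have h2 : l.map (genProj (Function.update α k a)) = l.map (genProj α) := by
          refine List.map_congr_left fun k' hk' => ?_
          have : k' ≠ k := fun h => hl.1 (h ▸ hk')
          simp only [genProj, Function.update_of_ne this]
        rw [List.map_cons, List.prod_cons, h2, ← mul_assoc, genProj, Function.update_self] at h1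
        exact h1
      rw [List.map_cons, List.prod_cons, ← mul_assoc]
      refine ih hl.2 _ fun α => ?_
      have h0 := hup α 0
      have h1 := hup α 1
      split_ifs
      · have : T * stabGen k * (l.map (genProj α)).prod =
            T * ((2⁻¹ : ℂ) • (1 + ((-1 : ℂ) ^ (0 : Fin 2).val) • stabGen k)) *
              (l.map (genProj α)).prod -
            T * ((2⁻¹ : ℂ) • (1 + ((-1 : ℂ) ^ (1 : Fin 2).val) • stabGen k)) *
              (l.map (genProj α)).prod := by
          rw [← sub_mul, ← mul_sub, ← smul_sub]
          congr 2
          simp only [Fin.val_zero, Fin.val_one, pow_zero, pow_one, one_smul, neg_smul]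
          rw [show (1 + stabGen k - (1 + -stabGen k) : Op m n) = (2 : ℂ) • stabGen k by
            rw [two_smul]; abel, smul_smul]
          norm_num
        rw [this]
        exact V.sub_mem h0 h1
      · have : T * 1 * (l.map (genProj α)).prod =
            T * ((2⁻¹ : ℂ) • (1 + ((-1 : ℂ) ^ (0 : Fin 2).val) • stabGen k)) *
              (l.map (genProj α)).prod +
            T * ((2⁻¹ : ℂ) • (1 + ((-1 : ℂ) ^ (1 : Fin 2).val) • stabGen k)) *
              (l.map (genProj α)).prod := by
          rw [← add_mul, ← mul_add, ← smul_add]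
          congr 2
          simp only [Fin.val_zero, Fin.val_one, pow_zero, pow_one, one_smul, neg_smul]
          rw [show (1 + stabGen k + (1 + -stabGen k) : Op m n) = (2 : ℂ) • 1 by
            rw [two_smul]; abel, smul_smul]
          norm_num
        rw [this]
        exact V.add_mem h0 h1
  have := key _ (Finset.nodup_toList _) 1 fun α => by
    rw [one_mul, ← syndromeProj_eq]
    exact hV α
  rwa [one_mul] at this

lemma codeProj_mul_genProd (K : Finset (Gen m n)) : codeProj m n * genProd K = codeProj m n := by
  rw [genProd]
  generalize (Finset.univ : Finset (Gen m n)).toList = l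
  induction l with
  | nil => simp
  | cons k l ih =>
    rw [List.map_cons, List.prod_cons, ← mul_assoc]
    split_ifs
    · rw [codeProj_mul_stabGen, ih]
    · rw [mul_one, ih]

lemma xOp_mul_xOp (A B : Config m n) : xOp A * xOp B = xOp (A + B) := by
  simp [xOp, mono_mul_mono]

lemma genProd_eq_xOp (K : Finset (Gen m n)) (hK : ∀ k ∈ K, genZ k = ∅) :
    genProd K = xOp (∑ k ∈ K, genX k) := by
  have h1 : ∀ l : List (Gen m n), (l.map fun k => if k ∈ K then stabGen k else 1).prod =
      xOp (l.map fun k => if k ∈ K then genX k else 0).sum := by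
    intro l
    induction l with
    | nil => exact one_eq_mono
    | cons k l ih =>
      rw [List.map_cons, List.prod_cons, List.map_cons, List.sum_cons, ih, ← xOp_mul_xOp]
      congr 1
      split_ifs with hk
      · rw [stabGen_eq_mono, hK k hk]
        rfl
      · exact one_eq_mono
  rw [genProd, h1, Finset.sum_map_toList]
  congr 1
  simp

/-! ### Faults in a single timestep -/

/-- The indicator function of a set of qubits. -/
def flips (X : Finset (Qubit m n)) : Config m n := fun q => if q ∈ X then 1 else 0

lemma fin_two_mul_add : ∀ x y z : Fin 2, x * (y + z) = x * y + x * z := by decide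

lemma sgn_mul_mul (x y z : Fin 2) :
    sgn (x * y * z) = if x = 1 ∧ y = 1 ∧ z = 1 then -1 else 1 := by
  rw [sgn]
  congr 1
  revert x y z
  decide

lemma gatePhase_eq_sgn {a b c : Fin 3} (habc : ∀ x, x = a ∨ x = b ∨ x = c) (g : CCZGate m n)
    (y : Config m n) : gatePhase g y = sgn (y (a, g a) * y (b, g b) * y (c, g c)) := by
  rw [sgn_mul_mul, gatePhase]
  congr 1
  refine propext ⟨fun h => ⟨h a, h b, h c⟩, fun h x => ?_⟩
  rcases habc x with rfl | rfl | rfl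
  exacts [h.1, h.2.1, h.2.2]

/-- The second difference of the cubic form `x y z` in the directions `(α, β, 0)` and `(s, u, 0)`.
-/
lemma bit_identity : ∀ x y z α β s u : Fin 2,
    (x + s + α) * (y + u + β) * z + (x + s) * (y + u) * z + ((x + α) * (y + β) * z + x * y * z) =
      z * (α * u + β * s) := by decide

/-- The effect of a pair of `X` errors in blocks `a` and `b` and of a stabilizer of these blocks on
a CCZ gate is a `Z` operator in block `c`. -/
lemma gatePhase_four {a b c : Fin 3} (habc : ∀ x, x = a ∨ x = b ∨ x = c) (g : CCZGate m n)
    {A S : Config m n} (hA : ∀ x, A (c, x) = 0) (hS : ∀ x, S (c, x) = 0) (y : Config m n) :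
    gatePhase g (y + S + A) * gatePhase g (y + S) * (gatePhase g (y + A) * gatePhase g y) =
      sgn (y (c, g c) * (A (a, g a) * S (b, g b) + A (b, g b) * S (a, g a))) := by
  simp only [gatePhase_eq_sgn habc, ← sgn_add, Pi.add_apply, hA, hS, add_zero]
  rw [bit_identity]

namespace CCZCircuit
variable {C : CCZCircuit m n}

/-- The Pauli errors `X` and `Z` on two sets of qubits after timestep `t`. -/
def faultPattern (C : CCZCircuit m n) (t : Fin C.depth) (X Z : Finset (Qubit m n)) :
    C.ErrorPattern :=
  fun t' q => if t' = t then if q ∈ X then 1 else if q ∈ Z then 3 else 0 else 0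

/-- The CCZ gates after timestep `t`, with their timesteps. -/
def laterGates (C : CCZCircuit m n) (t : Fin C.depth) : Finset (Fin C.depth × CCZGate m n) :=
  Finset.univ.filter fun p => t < p.1 ∧ p.2 ∈ C.step p.1

lemma mem_laterGates {t : Fin C.depth} {p : Fin C.depth × CCZGate m n} :
    p ∈ C.laterGates t ↔ t < p.1 ∧ p.2 ∈ C.step p.1 := by
  simp [laterGates]

/-- The phase that a flip of `A` after timestep `t` picks up from the later gates. -/
def conePhase (C : CCZCircuit m n) (t : Fin C.depth) (A y : Config m n) : ℂ :=
  ∏ p ∈ C.laterGates t, gatePhase p.2 (y + A) * gatePhase p.2 y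

lemma star_conePhase (t : Fin C.depth) (A y : Config m n) :
    star (C.conePhase t A y) = C.conePhase t A y := by
  simp only [conePhase, star_prod, star_mul', star_gatePhase]

lemma xPart_faultPattern (t t' : Fin C.depth) (X Z : Finset (Qubit m n)) :
    xPart (C.faultPattern t X Z t') = if t' = t then flips X else 0 := by
  funext q
  simp only [xPart, faultPattern]
  by_cases h : t' = t
  · simp only [h, if_true, flips]
    split_ifs <;> rfl
  · simp only [h, if_false]
    rfl

lemma frame_faultPattern (t : Fin C.depth) (X Z : Finset (Qubit m n)) :
    frame (C.faultPattern t X Z) = flips X := by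
  simp [frame, xPart_faultPattern]

lemma frameBefore_faultPattern (t v : Fin C.depth) (X Z : Finset (Qubit m n)) :
    frameBefore (C.faultPattern t X Z) v = if t < v then flips X else 0 := by
  rw [frameBefore, Finset.sum_eq_single t]
  · simp [xPart_faultPattern]
  · intro s _ hs
    simp [xPart_faultPattern, hs]
  · simp

lemma framePhase_faultPattern (t : Fin C.depth) {X Z : Finset (Qubit m n)} (hXZ : Disjoint X Z)
    (y : Config m n) :
    framePhase (C.faultPattern t X Z) y = zPhase Z y * C.conePhase t (flips X) y := by
  rw [framePhase, Finset.prod_mul_distrib]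
  congr 1
  · rw [Finset.prod_eq_single t]
    · rw [frameBefore_faultPattern, if_neg (lt_irrefl t), add_zero, stringPhase, zPhase,
        ← Finset.prod_subset (Finset.subset_univ Z)]
      · refine Finset.prod_congr rfl fun q hq => ?_
        have : q ∉ X := Finset.disjoint_right.1 hXZ hq
        simp [faultPattern, this, hq, pauliPhase, zBit]
      · intro q _ hq
        simp only [faultPattern, if_true, hq, if_false]
        split_ifs <;> simp [pauliPhase, zBit]
    · intro t' _ ht'
      refine Finset.prod_eq_one fun q _ => ?_
      simp [faultPattern, ht', pauliPhase, zBit]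
    · simp
  · rw [conePhase, laterGates, Finset.prod_filter, ← Finset.univ_product_univ,
      Finset.prod_product]
    refine Finset.prod_congr rfl fun v _ => ?_
    rw [frameBefore_faultPattern]
    by_cases hv : t < v
    · simp only [hv, if_true, true_and, stepPhase, ← Finset.prod_mul_distrib]
      rw [← Finset.prod_subset (Finset.subset_univ (C.step v))]
      · exact Finset.prod_congr rfl fun g hg => by rw [if_pos hg]
      · intro g _ hg
        rw [if_neg hg]
    · simp only [hv, if_false, false_and, Finset.prod_const_one, add_zero, stepPhase,
        ← Finset.prod_mul_distrib, gatePhase_mul_self]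

/-- The rows of block `c` on which an `X` stabilizer `S` of the blocks `a` and `b`, moved past
errors `A` after timestep `t`, leaves a `Z` operator. -/
def residue (C : CCZCircuit m n) (t : Fin C.depth) (a b c : Fin 3) (A S : Config m n)
    (r : Fin m) : Fin 2 :=
  ∑ p ∈ C.laterGates t, if (p.2 c).1 = r then
    A (a, p.2 a) * S (b, p.2 b) + A (b, p.2 b) * S (a, p.2 a) else 0

lemma residue_add (t : Fin C.depth) (a b c : Fin 3) (A S S' : Config m n) (r : Fin m) :
    C.residue t a b c A (S + S') r = C.residue t a b c A S r + C.residue t a b c A S' r := by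
  rw [residue, residue, residue, ← Finset.sum_add_distrib]
  refine Finset.sum_congr rfl fun p _ => ?_
  split_ifs
  · simp only [Pi.add_apply, fin_two_mul_add]
    exact add_add_add_comm _ _ _ _
  · simp

lemma residue_comm (t : Fin C.depth) (a b c : Fin 3) (A S : Config m n) (r : Fin m) :
    C.residue t a b c A S r = C.residue t b a c A S r := by
  simp only [residue]
  refine Finset.sum_congr rfl fun p _ => ?_
  rw [add_comm]

/-- By `gatePhase_four` each later gate leaves at most a `Z` on its qubit in block `c`. On
row-constant states only the row of that qubit counts, so the gates can be grouped by row. -/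
lemma conePhase_mul_conePhase (t : Fin C.depth) {a b c : Fin 3}
    (habc : ∀ x, x = a ∨ x = b ∨ x = c) {A S : Config m n} (hA : ∀ x, A (c, x) = 0)
    (hS : ∀ x, S (c, x) = 0) {y : Config m n} (hy : RowConst y) (j : Fin n) :
    C.conePhase t A (y + S) * C.conePhase t A y =
      ∏ r, if y (c, r, j) = 1 then sgn (C.residue t a b c A S r) else 1 := by
  have h1 : ∀ r, (if y (c, r, j) = 1 then sgn (C.residue t a b c A S r) else 1) =
      ∏ p ∈ C.laterGates t, if (p.2 c).1 = r then (if y (c, r, j) = 1 then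
        sgn (A (a, p.2 a) * S (b, p.2 b) + A (b, p.2 b) * S (a, p.2 a)) else 1) else 1 := by
    intro r
    split_ifs
    · rw [residue, sgn_sum]
      refine Finset.prod_congr rfl fun p _ => ?_
      split_ifs
      · rfl
      · exact sgn_zero
    · simp
  simp only [h1]
  rw [Finset.prod_comm, conePhase, conePhase, ← Finset.prod_mul_distrib]
  refine Finset.prod_congr rfl fun p _ => ?_
  rw [gatePhase_four habc p.2 hA hS, Finset.prod_ite_eq, if_pos (Finset.mem_univ _),
    hy c (p.2 c).1 j (p.2 c).2]
  split_ifs with h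
  · change sgn (y (c, (p.2 c).1, (p.2 c).2) * _) = _
    rw [h]
    congr 1
    generalize A (a, p.2 a) * S (b, p.2 b) + A (b, p.2 b) * S (a, p.2 a) = z
    revert z
    decide
  · change sgn (y (c, (p.2 c).1, (p.2 c).2) * _) = _
    have h0 : y (c, (p.2 c).1, (p.2 c).2) = 0 := by
      by_contra h'
      exact h (fin_two_eq_one h')
    rw [h0]
    have : ∀ z : Fin 2, (0 : Fin 2) * z = 0 := by decide
    rw [this, sgn_zero]

/-- A row of block `c` met by the lightcone of a flip of `g a` is met by the residue of a
stabilizer of block `b`. -/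
lemma exists_residue_ne_zero (hm : 3 ≤ m) (hred : C.IsReduced) {t : Fin C.depth}
    {g : CCZGate m n} {a b c : Fin 3} (hab : a ≠ b) (hac : a ≠ c) (hbc : b ≠ c)
    (habc : ∀ x, x = a ∨ x = b ∨ x = c)
    (hlate : ∀ v, t < v → ∀ h ∈ C.step v, ∀ b, (rowsMet b (C.modifiedLightcone v h)).card ≤ 2)
    {A : Config m n} (hA : ∀ x, A (a, x) = if x = g a then 1 else 0)
    {v : Fin C.depth} (hv : t < v) {h : CCZGate m n} (hh : h ∈ C.step v) (hag : h a = g a) :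
    ∃ i : Fin (m - 1), C.residue t a b c A (genX (Sum.inr (b, i))) (h c).1 = 1 := by
  -- `G ρ` is the parity of the later gates on the qubit `g a` that act on row `ρ` of `b` and on the
  -- row of `h` in `c`. The residue of the generator of rows `i, i + 1` is `G i + G (i + 1)`, so it
  -- suffices that `G` is not constant.
  set G : Fin m → Fin 2 := fun ρ => ∑ p ∈ C.laterGates t,
    if (p.2 c).1 = (h c).1 ∧ p.2 a = g a ∧ (p.2 b).1 = ρ then 1 else 0 with hG
  have h1 : G (h b).1 = 1 := by
    rw [hG]
    dsimp only
    rw [Finset.sum_eq_single (v, h)]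
    · simp [hag]
    · rintro ⟨v', h'⟩ hp hne
      rw [mem_laterGates] at hp
      refine if_neg fun ⟨h1, h2, h3⟩ => hne ?_
      dsimp only at h1 h2 h3 hp
      -- Reducedness makes `h` the only gate counted by `G` on its own row.
      have heq : h' = h := hred v' v h' hp.2 h hh ⟨a, h2.trans hag.symm⟩ fun x => by
        rcases habc x with rfl | rfl | rfl
        exacts [by rw [h2, hag], h3, h1]
      subst heq
      rw [C.no_repeat v' v h' hp.2 hh]
    · intro hp
      exact absurd (mem_laterGates.2 ⟨hv, hh⟩) hp
  -- After `t` all lightcones are small, so the gates on `g a` meet at most two of the `m ≥ 3` rows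
  -- of `b`.
  obtain ⟨ρ, h0⟩ : ∃ ρ, G ρ = 0 := by
    have hle := card_gateRows_le (k := t.val + 1) (c := b)
      (fun v hv h hh => hlate v hv h hh b) (a, g a)
    obtain ⟨ρ, -, hρ⟩ := Finset.exists_mem_notMem_of_card_lt_card
      (s := C.gateRows (t.val + 1) (a, g a) b) (t := Finset.univ)
      (by rw [Finset.card_univ, Fintype.card_fin]; omega)
    refine ⟨ρ, Finset.sum_eq_zero fun p hp => if_neg fun ⟨_, h2, h3⟩ => hρ ?_⟩
    rw [mem_laterGates] at hp
    exact mem_gateRows.2 ⟨p.1, hp.1, p.2, hp.2, mem_supp_mk.2 h2.symm, h3⟩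
  obtain ⟨i, hi⟩ := exists_adjacent_ne G (j := (h b).1) (j' := ρ) (by rw [h1, h0]; decide)
  refine ⟨i, ?_⟩
  have h2 : C.residue t a b c A (genX (Sum.inr (b, i))) (h c).1 =
      G ⟨i, by omega⟩ + G ⟨i + 1, by omega⟩ := by
    rw [hG]
    dsimp only
    rw [residue, ← Finset.sum_add_distrib]
    refine Finset.sum_congr rfl fun p _ => ?_
    have hS : (genX (Sum.inr (b, i)) : Config m n) (a, p.2 a) = 0 := by
      simp [genX, rowsFlip, hab]
    have hmul : ∀ z : Fin 2, z * 0 = 0 := by decide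
    rw [hS, hmul, add_zero, hA, genX_inr]
    simp only [Pi.add_apply, rowsFlip, true_and]
    by_cases e1 : (p.2 c).1 = (h c).1 <;> by_cases e2 : p.2 a = g a
    · simp [e1, e2]
    · simp [e1, e2]
    · simp [e1]
    · simp [e1]
  rw [h2]
  generalize G ⟨i, _⟩ = x at hi
  generalize G ⟨i + 1, _⟩ = y at hi
  revert x y
  decide


/-! ### Two-row lightcones are necessary -/

/-- The operators `T` for which `P E_f† T E_f' P` is a multiple of `P` up to `O(ε^d)`. -/
def correctableOps (f f' : C.ErrorPattern) (d : ℕ) : Submodule ℂ (Op m n) where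
  carrier := {T | ∃ γ : ℝ → ℂ, ∀ x y, (fun ε : ℝ =>
    (codeProj m n * (C.kraus ε f)ᴴ * T * C.kraus ε f' * codeProj m n
      - γ ε • codeProj m n) x y) =O[𝓝[>] (0 : ℝ)] fun ε : ℝ => ε ^ d}
  zero_mem' := ⟨0, fun x y => by simpa using isBigO_zero _ _⟩
  add_mem' := by
    rintro T T' ⟨γ, h⟩ ⟨γ', h'⟩
    refine ⟨γ + γ', fun x y => ((h x y).add (h' x y)).congr_left fun ε => ?_⟩
    rw [← Matrix.add_apply]
    refine congrFun (congrFun ?_ x) y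
    simp only [mul_add, add_mul, Pi.add_apply, add_smul]
    abel
  smul_mem' := by
    rintro a T ⟨γ, h⟩
    refine ⟨a • γ, fun x y => ((h x y).const_mul_left a).congr_left fun ε => ?_⟩
    rw [← smul_eq_mul, ← Matrix.smul_apply]
    refine congrFun (congrFun ?_ x) y
    simp only [mul_smul_comm, smul_mul_assoc, Pi.smul_apply, smul_sub, smul_smul, smul_eq_mul]
    rfl

/-- Two error patterns that lead to a logical `Z` operator have at least `d` errors together if the
noise has effective distance `d`. -/
lemma le_card_events_of_logicalZ (hm : 0 < m) {f f' : C.ErrorPattern} {d : ℕ} {T : Op m n}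
    (hT : T ∈ correctableOps f f' d) {c : Fin 3} {j : Fin n}
    (h : sandwich f f' T = zOp (col c j) * codeProj m n) :
    d ≤ (events f).card + (events f').card := by
  obtain ⟨γ, hγ⟩ := hT
  set R : Config m n := rowFlip c ⟨0, hm⟩ with hR
  have hp : codeProj m n R R = codeProj m n 0 0 := by
    have := (isScalarOnCode_codeProj (fun _ => (⟨0, hm⟩ : Fin m)) j).rowFlip_mem c ⟨0, hm⟩ 0 0
    simpa using this
  have hz : zPhase (col c j) R = -1 := by
    rw [zPhase_col]
    simp [hR, rowsFlip, sgn]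
  have hentry : ∀ ε x, (codeProj m n * (C.kraus ε f)ᴴ * T * C.kraus ε f' * codeProj m n
      - γ ε • codeProj m n) x x = ((C.amplitude f ε * C.amplitude f' ε : ℝ) : ℂ) *
        (zPhase (col c j) x * codeProj m n x x) - γ ε * codeProj m n x x := by
    intro ε x
    have h1 : codeProj m n * (C.propagated f)ᴴ * T * C.propagated f' * codeProj m n =
        zOp (col c j) * codeProj m n := h
    rw [kraus_sandwich, h1, Matrix.sub_apply, Matrix.smul_apply, Matrix.smul_apply, zOp,
      mono_mul_apply, add_zero, smul_eq_mul, smul_eq_mul]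
  -- `P` has equal diagonal entries at `0` and `R`, while the logical `Z` has opposite signs there:
  -- `γ` cancels in the difference and the amplitudes remain.
  have h2 := ((hγ 0 0).sub (hγ R R)).const_mul_left ((2 * codeProj m n 0 0)⁻¹)
  have h3 : (fun ε : ℝ => ((C.amplitude f ε * C.amplitude f' ε : ℝ) : ℂ)) =O[𝓝[>] (0 : ℝ)]
      fun ε : ℝ => ε ^ d := by
    refine h2.congr_left fun ε => ?_
    have h0 : codeProj m n 0 0 ≠ 0 := codeProj_zero_zero_ne_zero
    rw [hentry, hentry, hp, hz, zPhase_zero]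
    field_simp
    ring
  have h4 : (fun ε : ℝ => C.amplitude f ε * C.amplitude f' ε) =O[𝓝[>] (0 : ℝ)]
      fun ε : ℝ => ε ^ d := by
    refine IsBigO.of_norm_left (h3.norm_left.congr_left fun ε => ?_)
    rw [Complex.norm_real]
  have h5 := ((amplitude_isTheta f).mul (amplitude_isTheta f')).symm.isBigO.trans h4
  simp only [← pow_add] at h5
  by_contra! hlt
  have h6 := h5.trans_isLittleO ((isLittleO_pow_pow hlt).mono nhdsWithin_le_nhds)
  refine isLittleO_irrefl (Filter.Eventually.frequently ?_) h6
  filter_upwards [self_mem_nhdsWithin] with ε hε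
  exact pow_ne_zero _ (ne_of_gt hε)

/-- The faults `X` on a set `X`, and the same faults together with `Z` on a set `Z`, lead to a
logical `Z` operator if `Z` complements the residue of a stabilizer. -/
lemma sandwich_faultPattern {t : Fin C.depth} {a b c : Fin 3}
    (habc : ∀ x, x = a ∨ x = b ∨ x = c) {X : Finset (Qubit m n)} (hX : ∀ x, (c, x) ∉ X)
    {S : Config m n} (hS : ∀ x, S (c, x) = 0) (hPS : codeProj m n * xOp S = codeProj m n)
    (pos : Fin m → Fin n) (j : Fin n) :
    sandwich (C.faultPattern t X ∅) (C.faultPattern t X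
      ((Finset.univ.filter fun r => C.residue t a b c (flips X) S r = 0).image
        fun r => (c, r, pos r))) (xOp S) = zOp (col c j) * codeProj m n := by
  set Z : Finset (Qubit m n) := (Finset.univ.filter fun r =>
    C.residue t a b c (flips X) S r = 0).image fun r => (c, r, pos r) with hZ
  have hXZ : Disjoint X Z := by
    rw [Finset.disjoint_right]
    intro q hq
    obtain ⟨r, -, rfl⟩ := Finset.mem_image.1 hq
    exact hX _
  have hA : ∀ x, flips X (c, x) = 0 := fun x => by simp [flips, hX]
  have h1 : framePhase (C.faultPattern t X ∅) = C.conePhase t (flips X) := by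
    funext y
    rw [framePhase_faultPattern t (Finset.disjoint_empty_right X), zPhase, Finset.prod_empty,
      one_mul]
  have h2 : framePhase (C.faultPattern t X Z) =
      fun y => zPhase Z y * C.conePhase t (flips X) y :=
    funext fun y => framePhase_faultPattern t hXZ y
  have h3 : (C.propagated (C.faultPattern t X ∅))ᴴ * xOp S * C.propagated (C.faultPattern t X Z) =
      xOp S * mono 0 fun y => C.conePhase t (flips X) (y + S) *
        (zPhase Z y * C.conePhase t (flips X) y) := by
    rw [propagated_eq_mono, propagated_eq_mono, frame_faultPattern, frame_faultPattern, h1, h2,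
      mono_conjTranspose, xOp, mono_mul_mono, mono_mul_mono, mono_mul_mono, add_zero]
    simp only [star_conePhase, mul_one, one_mul]
    rw [add_right_comm, Config.add_self, zero_add]
    congr 1
    funext y
    rw [show y + flips X + S + flips X = y + S by
      rw [add_right_comm (y + flips X), Config.add_add_cancel]]
  have h4 : (mono 0 fun y => C.conePhase t (flips X) (y + S) *
      (zPhase Z y * C.conePhase t (flips X) y)) * codeProj m n =
      zOp (col c j) * codeProj m n := by
    ext x y
    rw [zOp, mono_mul_apply, mono_mul_apply, add_zero]
    by_cases hx : RowConst x
    · congr 1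
      rw [mul_left_comm, conePhase_mul_conePhase t habc hA hS hx j, zPhase_col, sgn_sum, hZ,
        zPhase, Finset.prod_image (by intro r _ r' _ h; simpa using congrArg (·.2.1) h),
        Finset.prod_filter, ← Finset.prod_mul_distrib]
      refine Finset.prod_congr rfl fun r _ => ?_
      -- On a constant row the column of a `Z` is immaterial, which is why `pos` is arbitrary.
      rw [hx c r (pos r) j]
      generalize C.residue t a b c (flips X) S r = w
      generalize x (c, r, j) = u
      fin_cases w <;> fin_cases u <;> simp [sgn]
    · by_cases hm : Nonempty (Fin m)
      · rw [(isScalarOnCode_codeProj (fun _ => hm.some) j).eq_zero_left hx, mul_zero, mul_zero]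
      · exact absurd (fun _ i => absurd ⟨i⟩ hm) hx
  rw [sandwich, mul_assoc (codeProj m n), mul_assoc (codeProj m n), h3, ← mul_assoc, hPS,
    mul_assoc, h4, ← mul_assoc]
  have h5 : codeProj m n * zOp (col c j) = zOp (col c j) * codeProj m n :=
    (commute_syndromeProj (zOp_col_commute c j) _).eq.symm
  rw [h5, mul_assoc, codeProj_mul_self]

lemma mem_events_faultPattern {t : Fin C.depth} {X Z : Finset (Qubit m n)}
    {e : Fin C.depth × Finset (Qubit m n)} (he : e ∈ events (C.faultPattern t X Z)) :
    e.1 = t ∧ e.2 ∈ C.gateSupports t ∧ ∃ q ∈ e.2, q ∈ X ∪ Z := by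
  obtain ⟨hs, q, hq, h⟩ := mem_events.1 he
  have ht : e.1 = t := by
    by_contra hne
    exact h (by simp [faultPattern, hne])
  refine ⟨ht, ht ▸ hs, q, hq, ?_⟩
  rw [Finset.mem_union]
  by_contra! hq'
  exact h (by simp [faultPattern, hq'.1, hq'.2])

/-- Faults in `k` qubits outside the support of a gate `g`, and in `g`, are at most `k + 1`
errors. -/
lemma card_events_faultPattern_le {t : Fin C.depth} {g : CCZGate m n} (hg : g ∈ C.step t)
    {X Z : Finset (Qubit m n)} {ι : Type*} [DecidableEq ι] (I : Finset ι) (q : ι → Qubit m n)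
    (h : ∀ x ∈ X ∪ Z, x ∈ supp g ∨ ∃ i ∈ I, q i = x) :
    (events (C.faultPattern t X Z)).card ≤ I.card + 1 := by
  choose cell hcell hmem using fun x => exists_mem_gateSupports (C := C) t x
  have hsub : events (C.faultPattern t X Z) ⊆
      insert (t, supp g) (I.image fun i => (t, cell (q i))) := by
    intro e he
    obtain ⟨ht, hs, x, hx, hxX⟩ := mem_events_faultPattern he
    rw [Finset.mem_insert, Finset.mem_image]
    rcases h x hxX with hxg | ⟨i, hi, rfl⟩
    · exact Or.inl (Prod.ext ht (eq_of_mem_gateSupports hs (supp_mem_gateSupports hg) hx hxg))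
    · exact Or.inr ⟨i, hi, Prod.ext ht.symm (eq_of_mem_gateSupports (hcell _) hs (hmem _) hx)⟩
  exact (Finset.card_le_card hsub).trans ((Finset.card_insert_le _ _).trans
    (Nat.add_le_add_right Finset.card_image_le 1))

lemma twoRowLightcones_of_hasEffectiveDistanceSPR (hm : 3 ≤ m) (hmn : m ≤ n)
    (hred : C.IsReduced) (hC : HasEffectiveDistanceSPR C.kraus m) : C.TwoRowLightcones := by
  by_contra hnot
  have hbad : ∃ t, ∃ g ∈ C.step t, ∃ c, 2 < (rowsMet c (C.modifiedLightcone t g)).card := by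
    simpa [TwoRowLightcones] using hnot
  -- The last timestep with a large lightcone, so that all later lightcones are small.
  obtain ⟨t, ⟨g, hg, c, hc⟩, hmax⟩ := WellFounded.has_min (wellFounded_gt (α := Fin C.depth))
    {t | ∃ g ∈ C.step t, ∃ c, 2 < (rowsMet c (C.modifiedLightcone t g)).card} hbad
  have hlate : ∀ v, t < v → ∀ h ∈ C.step v, ∀ b,
      (rowsMet b (C.modifiedLightcone v h)).card ≤ 2 := by
    intro v hv h hh b
    by_contra! hlt
    exact hmax v ⟨h, hh, b, hlt⟩ hv
  obtain ⟨a, b, hab, hac, hbc, habc⟩ : ∃ a b : Fin 3, a ≠ b ∧ a ≠ c ∧ b ≠ c ∧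
      ∀ x, x = a ∨ x = b ∨ x = c := by
    clear * -
    revert c
    decide
  have habc' : ∀ x, x = b ∨ x = a ∨ x = c := fun x => by rcases habc x with h | h | h <;> simp [h]
  set X : Finset (Qubit m n) := {(a, g a), (b, g b)} with hX
  have hXa : ∀ x, flips X (a, x) = if x = g a then 1 else 0 := fun x => by simp [flips, hX, hab]
  have hXb : ∀ x, flips X (b, x) = if x = g b then 1 else 0 := fun x => by
    simp [flips, hX, hab.symm]
  -- A later gate that reaches a new row of `c` shares with `g` its qubit in `a` or in `b`; the
  -- stabilizer is taken in the other of these two blocks.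
  have hhit : ∀ r ∈ rowsMet c (C.modifiedLightcone t g), r ≠ (g c).1 →
      ∃ b' ≠ c, ∃ i, C.residue t a b c (flips X) (genX (Sum.inr (b', i))) r = 1 := by
    intro r hr hne
    obtain ⟨v, hv, h1 | ⟨h, hh, rfl, x, hx⟩⟩ := mem_rowsMet_modifiedLightcone.1 hr
    · exact absurd h1 hne
    · rcases habc x with rfl | rfl | rfl
      · exact ⟨b, hbc, exists_residue_ne_zero hm hred hab hac hbc habc hlate hXa hv hh hx⟩
      · obtain ⟨i, hi⟩ := exists_residue_ne_zero hm hred hab.symm hbc hac habc' hlate hXb hv hh hx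
        exact ⟨a, hac, i, by rw [residue_comm, hi]⟩
      · exact absurd (by rw [hx]) hne
  have herase := Finset.pred_card_le_card_erase
    (s := rowsMet c (C.modifiedLightcone t g)) (a := (g c).1)
  obtain ⟨r₂, h₂, r₃, h₃, h₂₃⟩ : ∃ r₂ ∈ (rowsMet c (C.modifiedLightcone t g)).erase (g c).1,
      ∃ r₃ ∈ (rowsMet c (C.modifiedLightcone t g)).erase (g c).1, r₂ ≠ r₃ :=
    Finset.one_lt_card.1 (by omega)
  rw [Finset.mem_erase] at h₂ h₃
  -- Either one of the two generators found for `r₂` and `r₃` already hits both rows, or each hits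
  -- only its own and, the residue being additive, their product hits both.
  obtain ⟨K, hK, hK₂, hK₃⟩ : ∃ K : Finset (Gen m n),
      (∀ k ∈ K, ∃ b' ≠ c, ∃ i, k = Sum.inr (b', i)) ∧
      C.residue t a b c (flips X) (∑ k ∈ K, genX k) r₂ = 1 ∧
      C.residue t a b c (flips X) (∑ k ∈ K, genX k) r₃ = 1 := by
    obtain ⟨b₂, hb₂, i₂, hi₂⟩ := hhit r₂ h₂.2 h₂.1
    obtain ⟨b₃, hb₃, i₃, hi₃⟩ := hhit r₃ h₃.2 h₃.1
    by_cases e₂ : C.residue t a b c (flips X) (genX (Sum.inr (b₂, i₂))) r₃ = 1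
    · exact ⟨{Sum.inr (b₂, i₂)}, by simpa using hb₂, by simpa using hi₂,
        by simpa using e₂⟩
    by_cases e₃ : C.residue t a b c (flips X) (genX (Sum.inr (b₃, i₃))) r₂ = 1
    · exact ⟨{Sum.inr (b₃, i₃)}, by simpa using hb₃, by simpa using e₃,
        by simpa using hi₃⟩
    have hne : (Sum.inr (b₂, i₂) : Gen m n) ≠ Sum.inr (b₃, i₃) := fun h => e₃ (by rw [← h, hi₂])
    have hz : ∀ x : Fin 2, x ≠ 1 → x = 0 := by decide
    refine ⟨{Sum.inr (b₂, i₂), Sum.inr (b₃, i₃)}, ?_, ?_, ?_⟩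
    · intro k hk
      rcases Finset.mem_insert.1 hk with rfl | hk
      · exact ⟨b₂, hb₂, i₂, rfl⟩
      · exact ⟨b₃, hb₃, i₃, Finset.mem_singleton.1 hk⟩
    · rw [Finset.sum_pair hne, residue_add, hi₂, hz _ e₃, add_zero]
    · rw [Finset.sum_pair hne, residue_add, hi₃, hz _ e₂, zero_add]
  set S : Config m n := ∑ k ∈ K, genX k with hS
  have hprod : genProd K = xOp S := genProd_eq_xOp K fun k hk => by
    obtain ⟨b', -, i, rfl⟩ := hK k hk
    rfl
  have hSc : ∀ x, S (c, x) = 0 := by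
    intro x
    rw [hS, Finset.sum_apply]
    refine Finset.sum_eq_zero fun k hk => ?_
    obtain ⟨b', hb', i, rfl⟩ := hK k hk
    simp [genX, rowsFlip, hb'.symm]
  have hXc : ∀ x, (c, x) ∉ X := fun x => by simp [hX, hac.symm, hbc.symm]
  -- In the row of `g` the `Z` is put on the qubit of `g`, where it belongs to the failure of `g`
  -- and costs nothing extra.
  set pos : Fin m → Fin n := fun r => if r = (g c).1 then (g c).2 else ⟨0, by omega⟩ with hpos
  have hsand := sandwich_faultPattern (t := t) habc hXc hSc
    (by rw [← hprod, codeProj_mul_genProd]) pos ⟨0, by omega⟩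
  set Z : Finset (Qubit m n) := (Finset.univ.filter fun r =>
    C.residue t a b c (flips X) S r = 0).image fun r => (c, r, pos r) with hZ
  have hXsupp : ∀ x ∈ X, x ∈ supp g := by
    intro x hx
    rw [hX, Finset.mem_insert, Finset.mem_singleton] at hx
    rcases hx with rfl | rfl <;> exact mem_supp_mk.2 rfl
  have hT : xOp S ∈ correctableOps (C.faultPattern t X ∅) (C.faultPattern t X Z) m := by
    rw [← hprod]
    refine genProd_mem _ (fun α => ?_) K
    obtain ⟨γ, -, hγ⟩ := hC
    exact ⟨fun ε => γ α ε _ _, fun x y => hγ α _ _ x y⟩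
  have hle := le_card_events_of_logicalZ (by omega) hT hsand
  have hcard1 : (events (C.faultPattern t X ∅)).card ≤ 1 := by
    have := card_events_faultPattern_le (X := X) (Z := ∅) hg (∅ : Finset (Fin m))
      (fun r => (c, r, pos r)) fun x hx => Or.inl (hXsupp x (by simpa using hx))
    simpa using this
  -- Rows `r₂` and `r₃` need no `Z`, and that of `g` is paid for by the failure of `g`.
  have hcard2 : (events (C.faultPattern t X Z)).card ≤ m - 3 + 1 := by
    have h1 := card_events_faultPattern_le (X := X) (Z := Z) hg
      (Finset.univ \ {(g c).1, r₂, r₃}) (fun r => (c, r, pos r)) fun x hx => by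
        rcases Finset.mem_union.1 hx with hx | hx
        · exact Or.inl (hXsupp x hx)
        · obtain ⟨r, hr, rfl⟩ := Finset.mem_image.1 hx
          have hr0 := (Finset.mem_filter.1 hr).2
          by_cases hr1 : r = (g c).1
          · left
            rw [mem_supp_mk, hpos]
            simp [hr1]
          · refine Or.inr ⟨r, ?_, rfl⟩
            have hr2 : r ≠ r₂ := by
              rintro rfl
              rw [hK₂] at hr0
              exact absurd hr0 (by decide)
            have hr3 : r ≠ r₃ := by
              rintro rfl
              rw [hK₃] at hr0
              exact absurd hr0 (by decide)
            simp [hr1, hr2, hr3]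
    have h2 : ({(g c).1, r₂, r₃} : Finset (Fin m)).card = 3 :=
      Finset.card_eq_three.2 ⟨_, _, _, h₂.1.symm, h₃.1.symm, h₂₃, rfl⟩
    rw [Finset.card_sdiff_of_subset (Finset.subset_univ _), Finset.card_univ, Fintype.card_fin,
      h2] at h1
    exact h1
  omega

end CCZCircuit

end BaconShorCCZ

end

theorem mainTheorem3 (m n : ℕ) (hm : 3 ≤ m) (hmn : m ≤ n)
    (C : BaconShorCCZ.CCZCircuit m n) :
    (C.TwoRowLightcones → BaconShorCCZ.HasEffectiveDistanceSPR C.kraus m) ∧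
    (C.IsReduced → BaconShorCCZ.HasEffectiveDistanceSPR C.kraus m → C.TwoRowLightcones) :=
  ⟨BaconShorCCZ.CCZCircuit.hasEffectiveDistanceSPR_of_twoRowLightcones hmn,
    BaconShorCCZ.CCZCircuit.twoRowLightcones_of_hasEffectiveDistanceSPR hm hmn⟩
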